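/- **Setting.** A *graph* is a finite nonempty simple graph $A$ on vertices $1,\dots,n$ with a feature vector $x_v\in\mathbb R^d$ at every vertex ($d=0$ or constant features give plain graphs); isomorphisms preserve features. A *full set of eigenfunctions* of $A$ is an orthonormal basis $u_1,\dots,u_n$ of eigenvectors of the graph Laplacian (degree minus adjacency matrix), in any order, with eigenvalues $\lambda_1,\dots,\lambda_n$; the input of node $v$ is $x_v\,\|\,(u_1(v),\dots,u_n(v),0,\dots,0)\,\|\,(\lambda_1,\dots,\lambda_n,0,\dots,0)$, with both blocks padded to length $N\ge n$. A *Graph Mamba Network* (GMN) is here one with node tokenization ($m=0$) and without message passing. An affine encoder is applied to each node input, then one or more bidirectional Mamba blocks to each node as a sequence of length one, then one or more bidirectional Mamba blocks to the sequence of all nodes; the real output is a linear functional of the mean of the resulting node encodings. A bidirectional Mamba block maps a sequence $\Phi$ to $W_{\rm out}(Y_{\rm f}+\mathrm{Reverse}(Y_{\rm b}))$. Here $Y_{\rm f}=W_1\big(y\odot\sigma(W_2\,\mathrm{LN}(\Phi))\big)$ with $\Phi_{\rm in}=\sigma(\mathrm{Conv}(W_{\rm in}\mathrm{LN}(\Phi)))$,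 $B=W_B\Phi_{\rm in}$, $C=W_C\Phi_{\rm in}$, $\Delta=\mathrm{Softplus}(W_\Delta\Phi_{\rm in})$, and $y$ is the output of the selective state space model $h_t=\bar A_th_{t-1}+\bar B_t(\Phi_{\rm in})_t$, $y_t=C_th_t$, $h_0=0$, with $\bar A=\exp(\Delta A)$ and $\bar B=(\Delta A)^{-1}(\exp(\Delta A)-I)\,\Delta B$. Each channel has its own $\Delta$ and its own learnable diagonal $A$ with negative entries; $A$ and LN are shared by both directions. $\mathrm{LN}$ is layer normalization of each token with learnable gain and bias and a fixed stabilizer $\varepsilon>0$ added to the variance, $\mathrm{Conv}$ is a causal depthwise convolution with bias, and $\sigma$ is SiLU. $Y_{\rm b}$ is computed in the same way, with other weights, from the reversed sequence. All widths, the state dimension, the kernel width, the numbers of blocks and all weights are free ("enough parameters"). An *output* of a GMN on $A$ is its value for any choice of the full set of eigenfunctions and any order of the nodes. A GMN *distinguishes* $A$ and $B$ if some real number strictly separates all its outputs on $A$ from all its outputs on $B$. For $k\ge1$, the *$k$-WL test* colours each $k$-tuple $v$ of vertices first by its atomic type $\mathrm{atp}(v)$ (equalities, adjacencies, features). In each round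 it adds to the colour the multiset, over all vertices $w$, of $\big(\mathrm{atp}(v,w),c(v[w/1]),\dots,c(v[w/k])\big)$, where $v[w/i]$ is $v$ with its $i$-th entry replaced by $w$. It distinguishes two graphs if after some round their multisets of colours differ. **Theorem (Expressive power with positional encoding).** Let $\varepsilon>0$ and $d\ge0$. 1. For every finite $F\subset\mathbb R^d$, every $N$ and every $\delta>0$ there is a GMN such that, for all graphs $A,B$ with at most $N$ vertices and features in $F$: if $A\cong B$, then every output on $A$ differs from every output on $B$ by less than $\delta$; if $A\not\cong B$, then the GMN distinguishes $A$ and $B$, and every output on $A$ differs from every output on $B$ by at least $1$. 2. GMNs are more powerful than every Weisfeiler–Lehman test: (a) for every finite $F\subset\mathbb R^d$ and every $N$ there is a GMN that distinguishes any two graphs with at most $N$ vertices and features in $F$ that are distinguished by the $k$-WL test for some $k\ge1$; (b) for every $k\ge1$ and every $x\in\mathbb R^d$ there are non-isomorphic graphs, with feature vector $x$ at all vertices, that the $k$-WL test does not distinguish but some GMN (with $N$ at least both numbers of vertices) distinguishes. -/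

import Mathlib

namespace GraphMamba

/-! ### Graphs with node features -/

/-- A finite nonempty simple graph on the vertices `0, …, n-1`, with a feature vector in `ℝ^d`
at every vertex. For `d = 0` (or constant features) this is just a plain graph. -/
structure FeatGraph (d : ℕ) where
  n : ℕ
  n_pos : 0 < n
  graph : SimpleGraph (Fin n)
  feat : Fin n → Fin d → ℝ

/-- Isomorphism of graphs with node features. -/
def FeatGraph.IsIso {d : ℕ} (A B : FeatGraph d) : Prop :=
  ∃ e : A.graph ≃g B.graph, ∀ v, B.feat (e v) = A.feat v

open Classical in
/-- The graph Laplacian (degree matrix minus adjacency matrix). -/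
noncomputable def FeatGraph.laplacian {d : ℕ} (A : FeatGraph d) :
    Matrix (Fin A.n) (Fin A.n) ℝ :=
  A.graph.lapMatrix ℝ

/-- A full set of Laplacian eigenfunctions: an orthonormal basis `vec 0, …, vec (n-1)` of
eigenvectors with eigenvalues `val 0, …, val (n-1)`, listed in any order. -/
structure Eigenfunctions {d : ℕ} (A : FeatGraph d) where
  vec : Fin A.n → Fin A.n → ℝ
  val : Fin A.n → ℝ
  orthonormal : ∀ k l, vec k ⬝ᵥ vec l = if k = l then 1 else 0
  eigen : ∀ k, A.laplacian.mulVec (vec k) = val k • vec k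

/-- Extension of a vector of length `n` by zeros to length `N`. -/
def pad {n : ℕ} (N : ℕ) (x : Fin n → ℝ) : Fin N → ℝ :=
  fun i => if h : i.val < n then x ⟨i.val, h⟩ else 0

/-- The input vector of node `v`: its feature vector, concatenated with its positional encoding,
which consists of the values at `v` of all the eigenfunctions and of the eigenvalues they belong to
(both padded to length `N`). -/
def FeatGraph.nodeInput {d : ℕ} (A : FeatGraph d) (P : Eigenfunctions A) (N : ℕ) (v : Fin A.n) :
    Fin d ⊕ Fin N ⊕ Fin N → ℝ :=
  Sum.elim (A.feat v) (Sum.elim (pad N fun k => P.vec k v) (pad N P.val))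

/-! ### The bidirectional Mamba block -/

noncomputable def silu (x : ℝ) : ℝ := x / (1 + Real.exp (-x))

noncomputable def softplus (x : ℝ) : ℝ := Real.log (1 + Real.exp x)

/-- Layer normalization of one token, with gain `γ`, bias `β` and numerical stabilizer `ε`. -/
noncomputable def layerNorm {D : ℕ} (ε : ℝ) (γ β : Fin D → ℝ) (x : Fin D → ℝ) : Fin D → ℝ :=
  let μ := (∑ i, x i) / D
  let var := (∑ i, (x i - μ) ^ 2) / D
  fun i => γ i * ((x i - μ) / Real.sqrt (var + ε)) + β i

/-- Depthwise causal one-dimensional convolution along a sequence, with zero padding. -/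
def causalConv {n E K : ℕ} (κ : Fin E → Fin (K + 1) → ℝ) (b : Fin E → ℝ)
    (u : Fin n → Fin E → ℝ) : Fin n → Fin E → ℝ :=
  fun t e => b e + ∑ j : Fin (K + 1),
    if j.val ≤ t.val then κ e j * u ⟨t.val - j.val, lt_of_le_of_lt (Nat.sub_le _ _) t.isLt⟩ e
    else 0

/-- Zero-order-hold discretization `exp (ΔA)` of the state matrix. -/
noncomputable def discreteA (a Δ : ℝ) : ℝ := Real.exp (Δ * a)

/-- Zero-order-hold discretization `(ΔA)⁻¹ (exp (ΔA) - I) ΔB` of the input matrix. -/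
noncomputable def discreteB (a b Δ : ℝ) : ℝ := (Δ * a)⁻¹ * (Real.exp (Δ * a) - 1) * (Δ * b)

/-- The hidden state after `t` steps of `h_t = Ā_t h_{t-1} + B̄_t x_t`, started at `0`. Every
channel `e` has its own state in `ℝ^S` and its own diagonal state matrix with diagonal `Ā t e`. -/
def ssmState {n E S : ℕ} (Abar Bbar : Fin n → Fin E → Fin S → ℝ) (x : Fin n → Fin E → ℝ) :
    ℕ → Fin E → Fin S → ℝ
  | 0 => fun _ _ => 0
  | t + 1 => fun e s =>
      if h : t < n then
        Abar ⟨t, h⟩ e s * ssmState Abar Bbar x t e s + Bbar ⟨t, h⟩ e s * x ⟨t, h⟩ e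
      else ssmState Abar Bbar x t e s

/-- The state space model `h_t = Ā_t h_{t-1} + B̄_t x_t`, `y_t = C_t h_t`. -/
def ssm {n E S : ℕ} (Abar Bbar : Fin n → Fin E → Fin S → ℝ) (C : Fin n → Fin S → ℝ)
    (x : Fin n → Fin E → ℝ) : Fin n → Fin E → ℝ :=
  fun t e => ∑ s, C t s * ssmState Abar Bbar x (t.val + 1) e s

/-- Learnable weights of the scan in one direction: model dimension `D`, number of channels `E`,
state dimension `S`, convolution kernel of width `K + 1`. -/
structure ScanWeights (D E S K : ℕ) where
  Winput : Matrix (Fin E) (Fin D) ℝ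
  kernel : Fin E → Fin (K + 1) → ℝ
  kernelBias : Fin E → ℝ
  WB : Matrix (Fin S) (Fin E) ℝ
  WC : Matrix (Fin S) (Fin E) ℝ
  WDelta : Matrix (Fin E) (Fin E) ℝ
  W1 : Matrix (Fin D) (Fin E) ℝ
  W2 : Matrix (Fin E) (Fin D) ℝ

/-- One selective scan. The argument `Ψ` is the layer-normalized sequence, and `A e s` is the
`s`-th diagonal entry of the state matrix of channel `e`. -/
noncomputable def ScanWeights.scan {D E S K : ℕ} (w : ScanWeights D E S K)
    (A : Fin E → Fin S → ℝ) {n : ℕ} (Ψ : Fin n → Fin D → ℝ) : Fin n → Fin D → ℝ :=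
  let u : Fin n → Fin E → ℝ := fun t e =>
    silu (causalConv w.kernel w.kernelBias (fun r => w.Winput.mulVec (Ψ r)) t e)
  let B : Fin n → Fin S → ℝ := fun t => w.WB.mulVec (u t)
  let C : Fin n → Fin S → ℝ := fun t => w.WC.mulVec (u t)
  let Δ : Fin n → Fin E → ℝ := fun t e => softplus (w.WDelta.mulVec (u t) e)
  let y := ssm (fun t e s => discreteA (A e s) (Δ t e))
    (fun t e s => discreteB (A e s) (B t s) (Δ t e)) C u
  fun t => w.W1.mulVec fun e => y t e * silu (w.W2.mulVec (Ψ t) e)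

/-- A bidirectional Mamba block. The state matrices are `A = -exp logA`, shared by the two scans. -/
structure BiMamba (D E S K : ℕ) where
  gain : Fin D → ℝ
  bias : Fin D → ℝ
  logA : Fin E → Fin S → ℝ
  fwd : ScanWeights D E S K
  bwd : ScanWeights D E S K
  Wout : Matrix (Fin D) (Fin D) ℝ

/-- The output sequence `W_out (Y_f + Reverse Y_b)` of a bidirectional Mamba block, where `Y_f` is
obtained by scanning the tokens forward and `Y_b` by scanning the reversed sequence. -/
noncomputable def BiMamba.apply {D E S K : ℕ} (L : BiMamba D E S K) (ε : ℝ) {n : ℕ}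
    (Φ : Fin n → Fin D → ℝ) : Fin n → Fin D → ℝ :=
  let A : Fin E → Fin S → ℝ := fun e s => -Real.exp (L.logA e s)
  let Ψ : Fin n → Fin D → ℝ := fun t => layerNorm ε L.gain L.bias (Φ t)
  let Yf := L.fwd.scan A Ψ
  let Yb := L.bwd.scan A fun t => Ψ t.rev
  fun t => L.Wout.mulVec (Yf t + Yb t.rev)

/-- A stack of bidirectional Mamba blocks, the head of the list being applied first. -/
noncomputable def applyStack {D E S K : ℕ} (ε : ℝ) (Ls : List (BiMamba D E S K)) {n : ℕ}
    (Φ : Fin n → Fin D → ℝ) : Fin n → Fin D → ℝ :=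
  Ls.foldl (fun Ψ L => L.apply ε Ψ) Φ

/-! ### Graph Mamba networks -/

/-- A Graph Mamba Network with node tokenization (neighborhood radius `m = 0`, so that the token
sequence of a node is the node itself) and without message passing, on node features in `ℝ^d`
with positional encodings padded to graphs with at most `N` nodes. The hyperparameters and the
learnable parameters are fields: an affine token encoder, the bidirectional Mamba blocks applied to
the token sequence of each node, those applied to the sequence of all nodes, and a linear head. -/
structure GMN (d N : ℕ) where
  D : ℕ
  E : ℕ
  S : ℕ
  K : ℕ
  encW : Matrix (Fin D) (Fin d ⊕ Fin N ⊕ Fin N) ℝ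
  encB : Fin D → ℝ
  tokenLayers : List (BiMamba D E S K)
  tokenLayers_ne : tokenLayers ≠ []
  nodeLayers : List (BiMamba D E S K)
  nodeLayers_ne : nodeLayers ≠ []
  head : Fin D → ℝ

/-- The encoding of a node, computed from its token sequence (of length one). -/
noncomputable def GMN.encode {d N : ℕ} (g : GMN d N) (ε : ℝ)
    (x : Fin d ⊕ Fin N ⊕ Fin N → ℝ) : Fin g.D → ℝ :=
  applyStack ε g.tokenLayers (fun _ : Fin 1 => g.encW.mulVec x + g.encB) 0

/-- The updated node encodings of a sequence of nodes. -/
noncomputable def GMN.nodeEncodings {d N : ℕ} (g : GMN d N) (ε : ℝ) {n : ℕ}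
    (X : Fin n → (Fin d ⊕ Fin N ⊕ Fin N → ℝ)) : Fin n → Fin g.D → ℝ :=
  applyStack ε g.nodeLayers fun t => g.encode ε (X t)

/-- Graph-level output: the linear head applied to the mean of the updated node encodings. -/
noncomputable def GMN.eval {d N : ℕ} (g : GMN d N) (ε : ℝ) {n : ℕ}
    (X : Fin n → (Fin d ⊕ Fin N ⊕ Fin N → ℝ)) : ℝ :=
  (∑ t, g.head ⬝ᵥ g.nodeEncodings ε X t) / n

/-- All outputs of the network on a graph: one for every choice of the eigenfunctions and of the
order `π` in which the nodes are scanned. -/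
def GMN.outputs {d N : ℕ} (g : GMN d N) (ε : ℝ) (A : FeatGraph d) : Set ℝ :=
  {y | ∃ (P : Eigenfunctions A) (π : Equiv.Perm (Fin A.n)),
    y = g.eval ε fun t => A.nodeInput P N (π t)}

/-- The network tells the two graphs apart by a threshold on its output, whatever eigenfunctions
and node orders are chosen. -/
def GMN.Distinguishes {d N : ℕ} (g : GMN d N) (ε : ℝ) (A B : FeatGraph d) : Prop :=
  ∃ c : ℝ, ((∀ a ∈ g.outputs ε A, a < c) ∧ ∀ b ∈ g.outputs ε B, c < b) ∨
    ((∀ a ∈ g.outputs ε A, c < a) ∧ ∀ b ∈ g.outputs ε B, b < c)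

/-! ### The Weisfeiler-Lehman tests -/

/-- Atomic types of `k`-tuples of vertices: equalities, adjacencies and features. -/
abbrev AtomicType (d k : ℕ) : Type :=
  (Fin k → Fin k → Prop) × (Fin k → Fin k → Prop) × (Fin k → Fin d → ℝ)

def atomicType {d k : ℕ} (A : FeatGraph d) (v : Fin k → Fin A.n) : AtomicType d k :=
  (fun i j => v i = v j, fun i j => A.graph.Adj (v i) (v j), fun i => A.feat (v i))

/-- Colours of `k`-tuples after a given number of rounds. -/
def WLColor (d k : ℕ) : ℕ → Type
  | 0 => AtomicType d k
  | t + 1 => WLColor d k t × Multiset (AtomicType d (k + 1) × (Fin k → WLColor d k t))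

/-- The `k`-dimensional Weisfeiler-Lehman colouring. It starts with the atomic type of the tuple
`v`; in every round, the multiset of all
`(atp(v_1, …, v_k, w), c(v[w/1]), …, c(v[w/k]))`, for `w` a vertex, is added to the colour.
For `k = 1` this is colour refinement. -/
def wlColor {d : ℕ} (k : ℕ) (A : FeatGraph d) : (t : ℕ) → (Fin k → Fin A.n) → WLColor d k t
  | 0 => fun v => atomicType A v
  | t + 1 => fun v => (wlColor k A t v,
      (Finset.univ : Finset (Fin A.n)).val.map fun w =>
        (atomicType A (Fin.snoc (α := fun _ => Fin A.n) v w),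
          fun i => wlColor k A t (Function.update v i w)))

/-- The `k`-dimensional Weisfeiler-Lehman test distinguishes two graphs if after some round the
multisets of colours of their `k`-tuples differ. -/
def WLDistinguishes {d : ℕ} (k : ℕ) (A B : FeatGraph d) : Prop :=
  ∃ t : ℕ, (Finset.univ : Finset (Fin k → Fin A.n)).val.map (wlColor k A t) ≠
    (Finset.univ : Finset (Fin k → Fin B.n)).val.map (wlColor k B t)

end GraphMamba

namespace GraphMamba

/-! ### Density of shallow SiLU networks -/

/-! The node inputs determine the graph: the Laplacian entry at `v, w` is the sum over `k` of λ_k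
u_k(v) u_k(w), whichever eigenbasis is used, and its off-diagonal part is the adjacency relation. So
the multiset of node inputs fixes the graph up to isomorphism (`FeatGraph.isIso_of_nodeInput`),
although it depends on the eigenbasis.

Record a graph with an eigenbasis by the sums over its nodes of all continuous functions `g`, a
point of the product space `C(V, ℝ) → ℝ`. Eigenbases form a compact set and there are finitely many
graphs, so the records form finitely many compact pieces, and pieces of non-isomorphic graphs are
disjoint. Hence every isomorphism invariant is continuous on their union, and shallow SiLU networks
in the sums approximate it, by Stone–Weierstrass (`exists_silu_sum_near`,
`exists_gmn_near_invariant`).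

A Mamba network realizes these (`exists_gmn_near`). With constant selection and gate the scan is a
leaky sum of SiLU units. A token block approximates the functions `g`, prearranged so that the next
layer normalization returns them exactly. A node block with step kernels produces telescoping
increments, so the sum of its outputs depends exactly on the sum over all nodes, regardless of
order. Approximating twice the index of the isomorphism class gives part 1.

Isomorphic graphs pass every Weisfeiler–Lehman test, which gives 2(a). For 2(b), twisted and
untwisted Cai–Fürer–Immerman graphs over a complete graph on `k + 2` vertices are non-isomorphic,
but `k` pebbles never pin down where the parity defect sits. -/

theorem continuous_silu : Continuous silu := by
  unfold silu
  exact continuous_id.div (by fun_prop) fun x => by positivity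

/-- Far to the left SiLU behaves like `x * exp x`, so after rescaling, its shift by `-M` tends to
the exponential, uniformly on bounded sets, as `M` grows. -/
theorem abs_silu_shift_sub_exp_le {R M z : ℝ} (hM : 0 < M) (hz : |z| ≤ R) :
    |-(Real.exp M / M) * silu (-M + z) - Real.exp z| ≤
      Real.exp R * (R / M + Real.exp (R - M)) := by
  have hz' := abs_le.1 hz
  have h1 : -(Real.exp M / M) * silu (-M + z) - Real.exp z =
      -(Real.exp z * ((z / M + Real.exp (z - M)) / (1 + Real.exp (z - M)))) := by
    have : 1 + Real.exp (-(-M + z)) = (1 + Real.exp (z - M)) * (Real.exp M / Real.exp z) := by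
      rw [← Real.exp_sub, add_mul, ← Real.exp_add]
      simp only [one_mul, sub_add_sub_cancel, sub_self, Real.exp_zero]
      ring_nf
    rw [silu, this]
    have h2 := Real.exp_pos z
    have h3 := Real.exp_pos M
    have h4 := Real.exp_pos (z - M)
    field_simp
    ring
  have h2 : 0 < Real.exp (z - M) := Real.exp_pos _
  rw [h1, abs_neg, abs_mul, abs_of_pos (Real.exp_pos z), abs_div,
    abs_of_pos (show (0 : ℝ) < 1 + Real.exp (z - M) by positivity)]
  gcongr
  · exact hz'.2
  · calc |z / M + Real.exp (z - M)| / (1 + Real.exp (z - M))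
        ≤ |z / M + Real.exp (z - M)| := div_le_self (abs_nonneg _) (by linarith)
      _ ≤ |z / M| + |Real.exp (z - M)| := abs_add_le _ _
      _ ≤ R / M + Real.exp (R - M) := by
        rw [abs_div, abs_of_pos hM, abs_of_pos h2]
        gcongr
        exact hz'.2

/-- Shallow SiLU networks over an additive, point-separating family of continuous functions on a
compact space are dense in the continuous functions. -/
theorem exists_silu_sum_near {Y : Type*} [TopologicalSpace Y] [CompactSpace Y]
    (L : AddSubmonoid C(Y, ℝ)) (hL : ∀ x y : Y, x ≠ y → ∃ l ∈ L, l x ≠ l y)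
    (h : C(Y, ℝ)) {η : ℝ} (hη : 0 < η) :
    ∃ (m : ℕ) (c b : Fin m → ℝ) (l : Fin m → C(Y, ℝ)), (∀ i, l i ∈ L) ∧
      ∀ y, |∑ i, c i * silu (b i + l i y) - h y| < η := by
  let unit : ℝ → C(Y, ℝ) → C(Y, ℝ) := fun b l => ⟨fun y => silu (b + l y),
    continuous_silu.comp (continuous_const.add l.continuous)⟩
  let ex : C(Y, ℝ) → C(Y, ℝ) := fun l => ⟨fun y => Real.exp (l y), by fun_prop⟩
  let s : Set C(Y, ℝ) := {u | ∃ b, ∃ l ∈ L, u = unit b l}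
  -- Exponentials of elements of `L` are closed under products because `L` is closed under sums, so
  -- their linear span is already an algebra. It lies in the closure of the SiLU span, to which
  -- Stone–Weierstrass then applies.
  let P : Submonoid C(Y, ℝ) :=
    { carrier := {u | ∃ l ∈ L, u = ex l}
      one_mem' := ⟨0, L.zero_mem, by ext y; simp [ex]⟩
      mul_mem' := by
        rintro _ _ ⟨l, hl, rfl⟩ ⟨l', hl', rfl⟩
        exact ⟨l + l', L.add_mem hl hl', by ext y; simp [ex, Real.exp_add]⟩ }
  have hP : (P : Set C(Y, ℝ)) ⊆ (Submodule.span ℝ s).topologicalClosure := by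
    rintro _ ⟨l, hl, rfl⟩
    refine Metric.mem_closure_iff.2 fun r hr => ?_
    have hlim : Filter.Tendsto (fun M : ℝ => Real.exp ‖l‖ * (‖l‖ / M + Real.exp (‖l‖ - M)))
        Filter.atTop (nhds (Real.exp ‖l‖ * (0 + 0))) := by
      refine (Filter.Tendsto.add ?_ ?_).const_mul _
      · exact Filter.Tendsto.div_atTop tendsto_const_nhds Filter.tendsto_id
      · refine Real.tendsto_exp_atBot.comp ?_
        exact (Filter.tendsto_atBot_add_const_left _ ‖l‖ Filter.tendsto_neg_atTop_atBot).congr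
          fun M => (sub_eq_add_neg _ _).symm
    rw [add_zero, mul_zero] at hlim
    obtain ⟨M, hM, hM0⟩ := ((hlim.eventually (gt_mem_nhds hr)).and
      (Filter.eventually_gt_atTop 0)).exists
    refine ⟨-(Real.exp M / M) • unit (-M) l,
      Submodule.smul_mem _ _ (Submodule.subset_span ⟨_, l, hl, rfl⟩), ?_⟩
    rw [dist_comm]
    refine lt_of_le_of_lt ((ContinuousMap.dist_le (by positivity)).2 fun y => ?_) hM
    exact abs_silu_shift_sub_exp_le hM0 (l.norm_coe_le_norm y)
  have hadj : Subalgebra.toSubmodule (Algebra.adjoin ℝ (P : Set C(Y, ℝ))) ≤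
      (Submodule.span ℝ s).topologicalClosure := by
    rw [Algebra.adjoin_eq_span, Submonoid.closure_eq]
    exact Submodule.span_le.2 hP
  have hsep : (Algebra.adjoin ℝ (P : Set C(Y, ℝ))).SeparatesPoints := by
    intro x y hxy
    obtain ⟨l, hl, hne⟩ := hL x y hxy
    exact ⟨_, ⟨ex l, Algebra.subset_adjoin ⟨l, hl, rfl⟩, rfl⟩,
      fun he => hne (Real.exp_injective he)⟩
  have htop := ContinuousMap.subalgebra_topologicalClosure_eq_top_of_separatesPoints _ hsep
  have hmem : h ∈ closure ((Algebra.adjoin ℝ (P : Set C(Y, ℝ)) : Subalgebra ℝ C(Y, ℝ)) :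
      Set C(Y, ℝ)) := by
    rw [← Subalgebra.topologicalClosure_coe, htop]
    trivial
  have hmem' : h ∈ closure (Submodule.span ℝ s : Set C(Y, ℝ)) :=
    closure_minimal (s := ((Algebra.adjoin ℝ (P : Set C(Y, ℝ)) : Subalgebra ℝ C(Y, ℝ)) :
      Set C(Y, ℝ))) hadj isClosed_closure hmem
  obtain ⟨u, hu, hdist⟩ := Metric.mem_closure_iff.1 hmem' η hη
  obtain ⟨m, c, g, rfl⟩ := Submodule.mem_span_set'.1 hu
  choose b l hl hg using fun i => (g i).2
  refine ⟨m, c, b, l, hl, fun y => ?_⟩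
  have := (ContinuousMap.dist_apply_le_dist (f := h) (g := ∑ i, c i • (g i : C(Y, ℝ))) y).trans_lt
    hdist
  rw [dist_comm, Real.dist_eq] at this
  simpa [hg, unit, ContinuousMap.sum_apply] using this

/-! ### Mamba blocks with constant selection and gating -/

theorem silu_one_pos : 0 < silu 1 := by
  unfold silu
  positivity

/-- Zero pre-activation gives step size `softplus 0 = log 2`, so the state halves at every step. -/
theorem discreteA_softplus_zero : discreteA (-1) (softplus 0) = 1 / 2 := by
  rw [discreteA, softplus, Real.exp_zero, mul_neg_one, Real.exp_neg,
    Real.exp_log (by norm_num)]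
  norm_num

theorem discreteB_softplus_zero (b : ℝ) : discreteB (-1) b (softplus 0) = b / 2 := by
  have h : Real.log 2 ≠ 0 := (Real.log_pos one_lt_two).ne'
  have h2 : Real.exp (softplus 0 * -1) = 1 / 2 := discreteA_softplus_zero
  rw [discreteB, h2, softplus, Real.exp_zero, one_add_one_eq_two]
  field_simp
  norm_num

/-- The leaky sum `h_t = h_{t-1} / 2 + u_t` after `t` steps, started at `0`. -/
noncomputable def leakySum (u : ℕ → ℝ) : ℕ → ℝ
  | 0 => 0
  | t + 1 => leakySum u t / 2 + u t

/-- The pre-activation of a channel: a causal convolution of a scalar sequence. -/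
def convAt {K : ℕ} (κ : Fin (K + 1) → ℝ) (z : ℕ → ℝ) (t : ℕ) : ℝ :=
  ∑ j : Fin (K + 1), if j.val ≤ t then κ j * z (t - j) else 0

/-- The scalar sequence read off by the functional `w`, extended by zeros. -/
def readOff {D n : ℕ} (w : Fin D → ℝ) (Ψ : Fin n → Fin D → ℝ) (t : ℕ) : ℝ :=
  if h : t < n then w ⬝ᵥ Ψ ⟨t, h⟩ else 0

section Hidden

variable {D K : ℕ} {H : Type} [Fintype H]

/-- Position of a hidden unit, or of the constant channel `none`, among all channels. -/
noncomputable def channel (H : Type) [Fintype H] : Fin (Fintype.card (Option H)) ≃ Option H :=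
  (Fintype.equivFin (Option H)).symm

/-- Scan weights whose channels are the given hidden units together with a constant channel, which
makes `B`, `C` constant; `Δ` is constant and the gate reads off the coordinate `i₀`. -/
noncomputable def hiddenScan (i₀ : Fin D) (W : H → Fin D → ℝ) (κ : H → Fin (K + 1) → ℝ) (b : H → ℝ)
    (c : Fin D → H → ℝ) : ScanWeights D (Fintype.card (Option H)) 1 K where
  Winput := fun e => (channel H e).elim 0 W
  kernel := fun e => (channel H e).elim 0 κ
  kernelBias := fun e => (channel H e).elim 1 b
  WB := fun _ e => (channel H e).elim (2 / silu 1) fun _ => 0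
  WC := fun _ e => (channel H e).elim (1 / silu 1) fun _ => 0
  WDelta := 0
  W1 := fun i e => (channel H e).elim 0 fun h => c i h / silu 1
  W2 := fun _ => Pi.single i₀ 1

theorem sum_channel {g : Fin (Fintype.card (Option H)) → ℝ} (f : Option H → ℝ)
    (hg : ∀ e, g e = f (channel H e)) : ∑ e, g e = f none + ∑ h, f (some h) := by
  simp_rw [hg]
  rw [Equiv.sum_comp (channel H) f, Fintype.sum_option]

/-- The constant channel always carries `silu 1`; it is normalized so that `B = 2` and `C = 1`,
hence the discretized input matrix is `1`. The gate is `silu 1` because coordinate `i₀` is `1`, and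
`W1` divides it out. -/
theorem scan_hiddenScan (i₀ : Fin D) (W : H → Fin D → ℝ) (κ : H → Fin (K + 1) → ℝ) (b : H → ℝ)
    (c : Fin D → H → ℝ) {n : ℕ} (Ψ : Fin n → Fin D → ℝ) (hΨ : ∀ t, Ψ t i₀ = 1) (t : Fin n)
    (i : Fin D) :
    (hiddenScan i₀ W κ b c).scan (fun _ _ => -1) Ψ t i =
      ∑ h, c i h *
        leakySum (fun r => silu (b h + convAt (κ h) (readOff (W h) Ψ) r)) (t + 1) := by
  set w := hiddenScan i₀ W κ b c with hw
  set u : Fin n → Fin (Fintype.card (Option H)) → ℝ := fun t e =>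
    silu (causalConv w.kernel w.kernelBias (fun r => w.Winput.mulVec (Ψ r)) t e) with hu
  have q := silu_one_pos.ne'
  have u_eq : ∀ t e, u t e = (channel H e).elim (silu 1)
      fun h => silu (b h + convAt (κ h) (readOff (W h) Ψ) t) := by
    intro t e
    simp only [hu, causalConv, hw, hiddenScan, Matrix.mulVec]
    cases channel H e with
    | none => simp
    | some h =>
      simp only [Option.elim, convAt, readOff]
      congr 2
      refine Finset.sum_congr rfl fun j _ => ?_
      split_ifs with h1 h2
      · rfl
      · exact absurd (lt_of_le_of_lt (Nat.sub_le _ _) t.isLt) h2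
      · rfl
  have hB : ∀ t s, w.WB.mulVec (u t) s = 2 := by
    intro t s
    refine (sum_channel (fun o => o.elim (2 / silu 1) (fun _ => 0) *
      o.elim (silu 1) fun h => silu (b h + convAt (κ h) (readOff (W h) Ψ) t)) fun e => ?_).trans ?_
    · rw [u_eq, hw, hiddenScan]
    · simp [q]
  have hC : ∀ t s, w.WC.mulVec (u t) s = 1 := by
    intro t s
    refine (sum_channel (fun o => o.elim (1 / silu 1) (fun _ => 0) *
      o.elim (silu 1) fun h => silu (b h + convAt (κ h) (readOff (W h) Ψ) t)) fun e => ?_).trans ?_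
    · rw [u_eq, hw, hiddenScan]
    · simp [q]
  have hΔ : ∀ t e, w.WDelta.mulVec (u t) e = 0 := by
    intro t e
    simp [hw, hiddenScan]
  have hgate : ∀ t e, silu (w.W2.mulVec (Ψ t) e) = silu 1 := by
    intro t e
    rw [← hΨ t]
    simp [hw, hiddenScan, Matrix.mulVec]
  have hstate : ∀ (e : Fin (Fintype.card (Option H))) (s : Fin 1) (r : ℕ), r ≤ n →
      ssmState (fun t e s => discreteA (-1) (softplus (w.WDelta.mulVec (u t) e)))
        (fun t e s => discreteB (-1) (w.WB.mulVec (u t) s) (softplus (w.WDelta.mulVec (u t) e)))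
        u r e s = leakySum (fun r => (channel H e).elim (silu 1)
          fun h => silu (b h + convAt (κ h) (readOff (W h) Ψ) r)) r := by
    intro e s r
    induction r with
    | zero => intro _; rfl
    | succ r ih =>
      intro hr
      simp only [ssmState, leakySum]
      rw [dif_pos (show r < n by omega), ih (by omega), hΔ, hB,
        discreteA_softplus_zero, discreteB_softplus_zero, u_eq]
      ring
  have hy : w.scan (fun _ _ => -1) Ψ t i = ∑ e, w.W1 i e *
      (ssm (fun t e s => discreteA (-1) (softplus (w.WDelta.mulVec (u t) e)))
        (fun t e s => discreteB (-1) (w.WB.mulVec (u t) s) (softplus (w.WDelta.mulVec (u t) e)))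
        (fun t => w.WC.mulVec (u t)) u t e * silu (w.W2.mulVec (Ψ t) e)) := rfl
  rw [hy]
  refine (sum_channel (fun o => o.elim 0 (fun h => c i h / silu 1) *
    (leakySum (fun r => o.elim (silu 1) fun h => silu (b h + convAt (κ h) (readOff (W h) Ψ) r))
      (t + 1) * silu 1)) fun e => ?_).trans ?_
  · simp only [ssm, hgate, hC, Finset.univ_unique, Finset.sum_singleton, one_mul]
    rw [hstate e _ _ t.isLt]
    simp only [hw, hiddenScan]
  simp only [Option.elim, zero_mul, zero_add]
  refine Finset.sum_congr rfl fun h _ => ?_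
  field_simp

/-- A block that uses its forward scan only and whose layer normalization fixes the coordinate
`i₀` to be `1`. -/
noncomputable def hiddenBlock (i₀ : Fin D) (W : H → Fin D → ℝ) (κ : H → Fin (K + 1) → ℝ)
    (b : H → ℝ) (c : Fin D → H → ℝ) : BiMamba D (Fintype.card (Option H)) 1 K where
  gain := Function.update 1 i₀ 0
  bias := Pi.single i₀ 1
  logA := 0
  fwd := hiddenScan i₀ W κ b c
  bwd := hiddenScan i₀ W κ b 0
  Wout := 1

/-- Layer normalization with unit gain and no bias, except that the coordinate `i₀` is set
to `1`. -/
noncomputable def pinnedNorm (ε : ℝ) (i₀ : Fin D) (x : Fin D → ℝ) : Fin D → ℝ :=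
  layerNorm ε (Function.update 1 i₀ 0) (Pi.single i₀ 1) x

theorem pinnedNorm_self (ε : ℝ) (i₀ : Fin D) (x : Fin D → ℝ) : pinnedNorm ε i₀ x i₀ = 1 := by
  simp [pinnedNorm, layerNorm]

theorem pinnedNorm_of_ne (ε : ℝ) {i₀ i : Fin D} (hi : i ≠ i₀) (x : Fin D → ℝ) :
    pinnedNorm ε i₀ x i = layerNorm ε 1 0 x i := by
  simp [pinnedNorm, layerNorm, hi]

theorem apply_hiddenBlock (ε : ℝ) (i₀ : Fin D) (W : H → Fin D → ℝ) (κ : H → Fin (K + 1) → ℝ)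
    (b : H → ℝ) (c : Fin D → H → ℝ) {n : ℕ} (Φ : Fin n → Fin D → ℝ) (t : Fin n) (i : Fin D) :
    (hiddenBlock i₀ W κ b c).apply ε Φ t i =
      ∑ h, c i h * leakySum (fun r => silu (b h +
        convAt (κ h) (readOff (W h) fun s => pinnedNorm ε i₀ (Φ s)) r)) (t + 1) := by
  have hA : (fun (e : Fin (Fintype.card (Option H))) (s : Fin 1) =>
      -Real.exp ((hiddenBlock i₀ W κ b c).logA e s)) = fun _ _ => -1 := by
    simp [hiddenBlock]
  have h1 : (hiddenBlock i₀ W κ b c).apply ε Φ t =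
      (hiddenScan i₀ W κ b c).scan (fun _ _ => -1) (fun s => pinnedNorm ε i₀ (Φ s)) t +
      (hiddenScan i₀ W κ b 0).scan (fun _ _ => -1) (fun s => pinnedNorm ε i₀ (Φ s.rev)) t.rev := by
    rw [BiMamba.apply]
    simp only [hA]
    simp [hiddenBlock, pinnedNorm]
  rw [h1, Pi.add_apply, scan_hiddenScan _ _ _ _ _ _ fun s => pinnedNorm_self _ _ _,
    scan_hiddenScan _ _ _ _ _ _ fun s => pinnedNorm_self _ _ _]
  simp

end Hidden

/-! ### Exact summation along the sequence -/

/-- With `d r = v (r + 1) - v r`, the combined input is `d r - d (r - 1) / 2`, which is exactly what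
the leaky recursion inverts to `d`. Truncated subtraction `0 - 1 = 0` supplies the initial value
zero for the preceding increment. -/
theorem leakySum_telescope (v : ℕ → ℝ) (t : ℕ) :
    leakySum (fun r => v (r + 1)) t - 3 / 2 * leakySum v t + 1 / 2 * leakySum (fun r => v (r - 1)) t
      = v t - v (t - 1) := by
  induction t with
  | zero => simp [leakySum]
  | succ t ih =>
    simp only [leakySum, Nat.add_sub_cancel]
    linarith

/-- A kernel that is `1` from lag `s` on yields partial sums delayed by `s`, as long as the kernel
reaches back to the start of the sequence. -/
theorem convAt_step {K s t : ℕ} (htK : t ≤ K) (z : ℕ → ℝ) :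
    convAt (K := K) (fun j => if s ≤ j.val then 1 else 0) z t = ∑ r ∈ Finset.range (t + 1 - s), z r := by
  have h1 : convAt (K := K) (fun j => if s ≤ j.val then 1 else 0) z t =
      ∑ j ∈ Finset.range (K + 1), if s ≤ j ∧ j ≤ t then z (t - j) else 0 := by
    rw [Finset.sum_range, convAt]
    refine Finset.sum_congr rfl fun j _ => ?_
    split_ifs <;> simp_all
  rw [h1, ← Finset.sum_filter]
  refine Finset.sum_bij' (fun j _ => t - j) (fun r _ => t - r) ?_ ?_ ?_ ?_ ?_
  all_goals simp only [Finset.mem_filter, Finset.mem_range, implies_true]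
  all_goals intros; omega

/-- The kernels of the three channels that together sum up a hidden unit exactly. -/
def stepKernel {K : ℕ} (s : Fin 3) (j : Fin (K + 1)) : ℝ := if s.val ≤ j.val then 1 else 0

/-- Let `v m` be the unit evaluated at the sum of the first `m` terms. The lags 0, 1, 2 present `v`
at three consecutive times, and the weights of `leakySum_telescope` turn their leaky sums into `v (t
+ 1) - v t`; summing over time leaves only the end points. -/
theorem sum_telescope {K n : ℕ} (hn : n ≤ K + 1) (b : ℝ) (z : ℕ → ℝ) :
    ∑ t : Fin n, ∑ s : Fin 3, ![1, -(3 / 2), 1 / 2] s *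
      leakySum (fun r => silu (b + convAt (K := K) (stepKernel s) z r)) (t + 1) =
    silu (b + ∑ r ∈ Finset.range n, z r) - silu b := by
  let v : ℕ → ℝ := fun m => silu (b + ∑ r ∈ Finset.range m, z r)
  have hcong : ∀ (u u' : ℕ → ℝ) (t : ℕ), (∀ r < t, u r = u' r) → leakySum u t = leakySum u' t := by
    intro u u' t
    induction t with
    | zero => intro _; rfl
    | succ t ih =>
      intro h
      rw [leakySum, leakySum, ih fun r hr => h r (by omega), h t (by omega)]
  have hs : ∀ (s : Fin 3) (t : Fin n), leakySum (fun r => silu (b +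
      convAt (K := K) (stepKernel s) z r)) (t + 1) = leakySum (fun r => v (r + 1 - s)) (t + 1) := by
    intro s t
    refine hcong _ _ _ fun r hr => ?_
    have := convAt_step (K := K) (s := s) (t := r) (by omega) z
    simp only [v]
    rw [← this]
    rfl
  have ht : ∀ t : Fin n, ∑ s : Fin 3, ![1, -(3 / 2), 1 / 2] s *
      leakySum (fun r => silu (b + convAt (K := K) (stepKernel s) z r)) (t + 1) =
      v (t + 1) - v t := by
    intro t
    have := leakySum_telescope v (t + 1)
    simp only [hs, Fin.sum_univ_three]
    simp only [Matrix.cons_val_zero, Matrix.cons_val_one, Matrix.cons_val_two,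
      Matrix.head_cons, Matrix.tail_cons, Fin.val_zero, Fin.val_one, Fin.val_two, tsub_zero,
      Nat.add_sub_cancel] at this ⊢
    have h2 : (fun r => v (r + 1 - 2)) = fun r => v (r - 1) := by
      funext r
      congr 1
    rw [h2]
    linarith
  rw [Finset.sum_congr rfl fun t _ => ht t,
    ← Finset.sum_range (fun t => v (t + 1) - v t), Finset.sum_range_sub]
  simp [v]

/-! ### Layer normalization as a change of coordinates -/

theorem layerNorm_unit {D : ℕ} (ε : ℝ) (x : Fin D → ℝ) (i : Fin D) :
    layerNorm ε 1 0 x i = (x i - (∑ i, x i) / D) /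
      Real.sqrt ((∑ i, (x i - (∑ i, x i) / D) ^ 2) / D + ε) := by
  simp [layerNorm]

theorem continuous_layerNorm {D : ℕ} {ε : ℝ} (hε : 0 < ε) (γ β : Fin D → ℝ) :
    Continuous (layerNorm ε γ β) := by
  unfold layerNorm
  refine continuous_pi fun i => (continuous_const.mul (Continuous.div (by fun_prop) (by fun_prop)
    fun x => ?_)).add continuous_const
  have : 0 ≤ (∑ i, (x i - (∑ i, x i) / D) ^ 2) / D := by positivity
  exact (Real.sqrt_pos.2 (by linarith)).ne'

theorem continuous_pinnedNorm {D : ℕ} {ε : ℝ} (hε : 0 < ε) (i₀ : Fin D) :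
    Continuous (pinnedNorm ε i₀) :=
  continuous_layerNorm hε _ _

/-- Layer normalization is injective on vectors that share a coordinate. -/
theorem layerNorm_injective {D : ℕ} {ε : ℝ} (hε : 0 < ε) {x y : Fin D → ℝ} {i₁ : Fin D}
    (h₁ : x i₁ = y i₁) (h : ∀ i, layerNorm ε 1 0 x i = layerNorm ε 1 0 y i) : x = y := by
  simp only [layerNorm_unit] at h
  set μ := (∑ i, x i) / D
  set ν := (∑ i, y i) / D
  set v := (∑ i, (x i - μ) ^ 2) / D with hv
  set w := (∑ i, (y i - ν) ^ 2) / D with hw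
  have hv0 : 0 ≤ v := by positivity
  have hw0 : 0 ≤ w := by positivity
  set s := Real.sqrt (v + ε)
  set t := Real.sqrt (w + ε)
  have hs : 0 < s := Real.sqrt_pos.2 (by linarith)
  have ht : 0 < t := Real.sqrt_pos.2 (by linarith)
  have hs2 : s ^ 2 = v + ε := Real.sq_sqrt (by linarith)
  have ht2 : t ^ 2 = w + ε := Real.sq_sqrt (by linarith)
  have hx : ∀ i, x i - μ = s / t * (y i - ν) := by
    intro i
    have := h i
    field_simp at this ⊢
    linarith
  have hvw : v = (s / t) ^ 2 * w := by
    rw [hv, hw, ← mul_div_assoc, Finset.mul_sum]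
    congr 1
    exact Finset.sum_congr rfl fun i _ => by rw [hx i, mul_pow]
  -- Both the variances and the variances plus `ε` have ratio `(s / t) ^ 2`, which is possible with
  -- `ε > 0` only if the ratio is `1`. The common coordinate then identifies the means.
  have h1 : (s / t) ^ 2 = 1 := by
    have : (s / t) ^ 2 * t ^ 2 = s ^ 2 := by field_simp
    rw [ht2, hs2, mul_add, ← hvw] at this
    exact mul_right_cancel₀ hε.ne' (by linarith)
  have h2 : s / t = 1 := (pow_eq_one_iff_of_nonneg (div_pos hs ht).le two_ne_zero).1 h1
  simp only [h2, one_mul] at hx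
  ext i
  linarith [hx i, hx i₁]

/-- Every centred vector of variance less than `1` is a value of layer normalization. -/
theorem layerNorm_preimage {D : ℕ} {ε : ℝ} (hε : 0 < ε) {ψ : Fin D → ℝ} (h0 : ∑ i, ψ i = 0)
    (hq : (∑ i, ψ i ^ 2) / D < 1) :
    layerNorm ε 1 0 (Real.sqrt (ε / (1 - (∑ i, ψ i ^ 2) / D)) • ψ) = ψ := by
  set q := (∑ i, ψ i ^ 2) / D with hq'
  set r := Real.sqrt (ε / (1 - q)) with hr
  have h1 : 0 < 1 - q := by linarith
  have hr0 : 0 < r := Real.sqrt_pos.2 (by positivity)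
  have hr2 : r ^ 2 = ε / (1 - q) := Real.sq_sqrt (by positivity)
  ext i
  rw [layerNorm_unit]
  have hμ : ∑ i, (r • ψ) i = 0 := by simp [← Finset.mul_sum, h0]
  -- The scale `r` solves `r ^ 2 * q + ε = r ^ 2`, so the normalization divides by exactly `r`.
  have hvar : (∑ i, ((r • ψ) i - 0) ^ 2) / D + ε = r ^ 2 := by
    have : (∑ i, ((r • ψ) i - 0) ^ 2) / D = r ^ 2 * q := by
      simp only [sub_zero, Pi.smul_apply, smul_eq_mul, mul_pow]
      rw [← Finset.mul_sum, mul_div_assoc]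
    rw [this, hr2]
    field_simp
    ring
  rw [hμ, zero_div, hvar, Real.sqrt_sq hr0.le]
  simp [hr0.ne']

/-! ### Token-level approximation -/

section Token

variable {D : ℕ} {p : Type} [Fintype p]

/-- The matrix that places the coordinates of its argument at the positions `j`. -/
def placement (j : p → Fin D) : Matrix (Fin D) p ℝ := fun a i => if a = j i then 1 else 0

theorem placement_mulVec_apply [DecidableEq p] {j : p → Fin D} (hj : Function.Injective j) (x : p → ℝ) (i : p) :
    (placement j).mulVec x (j i) = x i := by
  simp [placement, Matrix.mulVec, dotProduct, hj.eq_iff]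

theorem placement_mulVec_of_forall_ne {j : p → Fin D} {a : Fin D} (ha : ∀ i, j i ≠ a)
    (x : p → ℝ) : (placement j).mulVec x a = 0 := by
  simp [placement, Matrix.mulVec, dotProduct, fun i => (ha i).symm]

/-- One block of hidden units approximates any continuous map of the token inputs. -/
theorem exists_token_units [DecidableEq p] {ε : ℝ} (hε : 0 < ε) {j : p → Fin D} (hj : Function.Injective j)
    {i₀ i₁ : Fin D} (hi : i₁ ≠ i₀) (h₀ : ∀ i, j i ≠ i₀) (h₁ : ∀ i, j i ≠ i₁) {T : Set (p → ℝ)}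
    (hT : IsCompact T) {φ : (p → ℝ) → Fin D → ℝ} (hφ : ContinuousOn φ T) {η : ℝ} (hη : 0 < η) :
    ∃ (H : Type) (_ : Fintype H) (W : H → Fin D → ℝ) (b : H → ℝ) (c : Fin D → H → ℝ),
      ∀ x ∈ T, ∀ i, |∑ h, c i h * silu (b h +
        W h ⬝ᵥ pinnedNorm ε i₀ ((placement j).mulVec x)) - φ x i| < η := by
  have : CompactSpace T := isCompact_iff_compactSpace.1 hT
  have hcont : Continuous fun x : T => pinnedNorm ε i₀ ((placement j).mulVec x.1) :=
    (continuous_pinnedNorm hε i₀).comp (by fun_prop)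
  let lin : (Fin D → ℝ) → C(T, ℝ) := fun w =>
    ⟨fun x => w ⬝ᵥ pinnedNorm ε i₀ ((placement j).mulVec x.1), by
      exact continuous_const.dotProduct hcont⟩
  let L : AddSubmonoid C(T, ℝ) :=
    { carrier := Set.range lin
      zero_mem' := ⟨0, by ext x; simp [lin]⟩
      add_mem' := by
        rintro _ _ ⟨w, rfl⟩ ⟨w', rfl⟩
        exact ⟨w + w', by ext x; simp [lin]⟩ }
  have hL : ∀ x y : T, x ≠ y → ∃ l ∈ L, l x ≠ l y := by
    intro x y hxy
    by_contra! hcon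
    apply hxy
    have hcoord : ∀ i, pinnedNorm ε i₀ ((placement j).mulVec x.1) i =
        pinnedNorm ε i₀ ((placement j).mulVec y.1) i := fun i => by
      simpa [lin] using hcon (lin (Pi.single i 1)) ⟨_, rfl⟩
    have hln : ∀ i, i ≠ i₀ → layerNorm ε 1 0 ((placement j).mulVec x.1) i =
        layerNorm ε 1 0 ((placement j).mulVec y.1) i := fun i hi => by
      rw [← pinnedNorm_of_ne ε hi, ← pinnedNorm_of_ne ε hi, hcoord]
    -- Pinning erases coordinate `i₀`, but `i₀` and `i₁` both hold zero before normalization, so the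
    -- erased value can be read at `i₁`.
    have hswap : ∀ z : p → ℝ, layerNorm ε 1 0 ((placement j).mulVec z) i₀ =
        layerNorm ε 1 0 ((placement j).mulVec z) i₁ := fun z => by
      rw [layerNorm_unit, layerNorm_unit, placement_mulVec_of_forall_ne h₀,
        placement_mulVec_of_forall_ne h₁]
    have hxy' : (placement j).mulVec x.1 = (placement j).mulVec y.1 := by
      refine layerNorm_injective hε (i₁ := i₁) ?_ fun i => ?_
      · rw [placement_mulVec_of_forall_ne h₁, placement_mulVec_of_forall_ne h₁]
      · by_cases hii : i = i₀
        · rw [hii, hswap, hswap, hln _ hi]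
        · exact hln i hii
    ext i
    rw [← placement_mulVec_apply hj x.1 i, hxy', placement_mulVec_apply hj]
  have hcomp : ∀ i, Continuous fun x : T => φ x.1 i := fun i =>
    (continuous_apply i).comp (continuousOn_iff_continuous_domRestrict.1 hφ)
  choose m c b l hl happ using fun i =>
    exists_silu_sum_near L hL ⟨fun x : T => φ x.1 i, hcomp i⟩ hη
  choose w hw using hl
  -- Each output coordinate gets its own group of hidden units.
  refine ⟨Σ i, Fin (m i), inferInstance, fun h => w h.1 h.2, fun h => b h.1 h.2,
    fun i h => if h.1 = i then c h.1 h.2 else 0, fun x hx i => ?_⟩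
  have := happ i ⟨x, hx⟩
  simp only [← hw, ContinuousMap.coe_mk] at this
  convert this using 3
  rw [Fintype.sum_sigma, Finset.sum_eq_single i]
  · simp [lin]
  · intro i' _ hne
    simp [hne]
  · simp

end Token

/-! ### Two-block networks -/

section Network

variable {d N D m : ℕ} {H : Type} [Fintype H]

/-- A block that applies a shallow network to each token of a sequence of length one. -/
noncomputable def tokenBlock (N m : ℕ) (i₀ : Fin D) (W : H → Fin D → ℝ) (b : H → ℝ)
    (c : Fin D → H → ℝ) : BiMamba D (Fintype.card (Option (H ⊕ Fin m × Fin 3))) 1 N :=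
  hiddenBlock i₀ (Sum.elim W 0) (fun _ => stepKernel 0) (Sum.elim b 0) fun i => Sum.elim (c i) 0

/-- A block that applies a shallow network to the sum of all tokens. -/
noncomputable def nodeBlock (N : ℕ) (H : Type) [Fintype H] (i₀ : Fin D) (W : Fin m → Fin D → ℝ)
    (b c : Fin m → ℝ) : BiMamba D (Fintype.card (Option (H ⊕ Fin m × Fin 3))) 1 N :=
  hiddenBlock i₀ (Sum.elim 0 fun e => W e.1) (Sum.elim 0 fun e => stepKernel e.2)
    (Sum.elim 0 fun e => b e.1) fun _ => Sum.elim 0 fun e => c e.1 * ![1, -(3 / 2), 1 / 2] e.2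

/-- On a single token the convolution and the leaky sum are both trivial. The units indexed by `Fin
m × Fin 3` are idle; they are there because token and node blocks must have the same number of
channels. -/
theorem apply_tokenBlock (N m : ℕ) (ε : ℝ) (i₀ : Fin D) (W : H → Fin D → ℝ) (b : H → ℝ)
    (c : Fin D → H → ℝ) (x : Fin D → ℝ) (i : Fin D) :
    (tokenBlock N m i₀ W b c).apply ε (fun _ : Fin 1 => x) 0 i =
      ∑ h, c i h * silu (b h + W h ⬝ᵥ pinnedNorm ε i₀ x) := by
  have hconv : ∀ z : ℕ → ℝ, convAt (K := N) (stepKernel 0) z 0 = z 0 := fun z =>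
    (convAt_step (s := 0) (Nat.zero_le N) z).trans (by simp)
  rw [tokenBlock, apply_hiddenBlock, Fintype.sum_sum_type]
  simp [leakySum, hconv, readOff]

theorem sum_apply_nodeBlock {N n : ℕ} (hn : n ≤ N) (ε : ℝ) (i₀ : Fin D) (W : Fin m → Fin D → ℝ)
    (b c : Fin m → ℝ) (z : Fin n → Fin D → ℝ) (i : Fin D) :
    ∑ t, (nodeBlock N H i₀ W b c).apply ε z t i =
      ∑ e, c e * (silu (b e + ∑ t, W e ⬝ᵥ pinnedNorm ε i₀ (z t)) - silu (b e)) := by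
  simp only [nodeBlock, apply_hiddenBlock, Fintype.sum_sum_type, Sum.elim_inl,
    Sum.elim_inr, Pi.zero_apply, zero_mul, Finset.sum_const_zero, zero_add, Fintype.sum_prod_type]
  rw [Finset.sum_comm]
  refine Finset.sum_congr rfl fun e _ => ?_
  have := sum_telescope (K := N) (n := n) (by omega) (b e)
    (readOff (W e) fun s => pinnedNorm ε i₀ (z s))
  rw [Finset.sum_range] at this
  simp only [readOff, Fin.is_lt, dite_true] at this
  rw [← this, Finset.mul_sum]
  refine Finset.sum_congr rfl fun t _ => ?_
  rw [Finset.mul_sum]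
  refine Finset.sum_congr rfl fun s _ => ?_
  rw [mul_assoc]

/-- The network with one token-level and one node-level block of hidden units. -/
noncomputable def twoBlock (i₀ : Fin D) (encW : Matrix (Fin D) (Fin d ⊕ Fin N ⊕ Fin N) ℝ)
    (W : H → Fin D → ℝ) (b : H → ℝ) (c : Fin D → H → ℝ)
    (W' : Fin m → Fin D → ℝ) (b' c' : Fin m → ℝ) : GMN d N where
  D := D
  E := Fintype.card (Option (H ⊕ Fin m × Fin 3))
  S := 1
  K := N
  encW := encW
  encB := 0
  tokenLayers := [tokenBlock N m i₀ W b c]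
  tokenLayers_ne := by simp
  nodeLayers := [nodeBlock N H i₀ W' b' c']
  nodeLayers_ne := by simp
  head := Pi.single i₀ 1

/-- The output of a two-block network as a function of the node encodings. -/
noncomputable def readout (ε : ℝ) (i₀ : Fin D) (W : Fin m → Fin D → ℝ) (b c : Fin m → ℝ) (n : ℕ)
    (z : Fin n → Fin D → ℝ) : ℝ :=
  (∑ e, c e * (silu (b e + ∑ t, W e ⬝ᵥ pinnedNorm ε i₀ (z t)) - silu (b e))) / n

theorem continuous_readout {ε : ℝ} (hε : 0 < ε) (i₀ : Fin D) (W : Fin m → Fin D → ℝ)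
    (b c : Fin m → ℝ) (n : ℕ) : Continuous (readout ε i₀ W b c n) := by
  unfold readout
  refine Continuous.div_const (continuous_finsetSum _ fun e _ => continuous_const.mul
    (Continuous.sub (continuous_silu.comp (continuous_const.add
      (continuous_finsetSum _ fun t _ => continuous_const.dotProduct
        ((continuous_pinnedNorm hε i₀).comp (continuous_apply t))))) continuous_const)) _

theorem eval_twoBlock (ε : ℝ) (i₀ : Fin D) (encW : Matrix (Fin D) (Fin d ⊕ Fin N ⊕ Fin N) ℝ)
    (W : H → Fin D → ℝ) (b : H → ℝ) (c : Fin D → H → ℝ) (W' : Fin m → Fin D → ℝ)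
    (b' c' : Fin m → ℝ) {n : ℕ} (hn : n ≤ N) (X : Fin n → Fin d ⊕ Fin N ⊕ Fin N → ℝ) :
    (twoBlock i₀ encW W b c W' b' c').eval ε X = readout ε i₀ W' b' c' n fun t i =>
      ∑ h, c i h * silu (b h + W h ⬝ᵥ pinnedNorm ε i₀ (encW.mulVec (X t))) := by
  have h1 : (twoBlock i₀ encW W b c W' b' c').eval ε X =
      (∑ t, (Pi.single i₀ 1 : Fin D → ℝ) ⬝ᵥ (nodeBlock N H i₀ W' b' c').apply ε (fun s =>
        (tokenBlock N m i₀ W b c).apply ε (fun _ : Fin 1 => encW.mulVec (X s) + 0) 0) t) / n := rfl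
  have h2 : ∀ t, (tokenBlock N m i₀ W b c).apply ε (fun _ : Fin 1 => encW.mulVec (X t)) 0 =
      fun i => ∑ h, c i h * silu (b h + W h ⬝ᵥ pinnedNorm ε i₀ (encW.mulVec (X t))) :=
    fun t => funext fun i => apply_tokenBlock N m ε i₀ W b c _ i
  rw [h1, readout]
  simp only [single_dotProduct, one_mul, add_zero, h2]
  rw [sum_apply_nodeBlock hn]

end Network

/-- Graph Mamba networks approximate all shallow networks of sums of continuous functions over the
nodes, uniformly over inputs from a compact set. -/
theorem exists_gmn_near {ε : ℝ} (hε : 0 < ε) {d N m : ℕ} {T : Set (Fin d ⊕ Fin N ⊕ Fin N → ℝ)}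
    (hT : IsCompact T) (b c : Fin m → ℝ) (g : Fin m → C(Fin d ⊕ Fin N ⊕ Fin N → ℝ, ℝ)) {η : ℝ}
    (hη : 0 < η) :
    ∃ G : GMN d N, ∀ n ≤ N, ∀ X : Fin n → Fin d ⊕ Fin N ⊕ Fin N → ℝ, (∀ t, X t ∈ T) →
      |G.eval ε X - (∑ e, c e * (silu (b e + ∑ t, g e (X t)) - silu (b e))) / n| < η := by
  let ι := (Fin d ⊕ Fin N ⊕ Fin N) ⊕ Fin m ⊕ Bool
  let D := Fintype.card ι
  let q : ι ≃ Fin D := Fintype.equivFin ι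
  let i₀ := q (.inr (.inr false))
  have hD : (1 : ℝ) ≤ D := by
    have : 0 < D := Fintype.card_pos_iff.2 ⟨.inr (.inr false)⟩
    exact_mod_cast this
  -- the node encodings before and after layer normalization
  let Q : (Fin d ⊕ Fin N ⊕ Fin N → ℝ) → ℝ := fun x => ∑ e, g e x ^ 2 + (∑ e, g e x) ^ 2
  have hQ0 : ∀ x, 0 ≤ Q x := fun x => by positivity
  obtain ⟨B, hB⟩ : ∃ B : ℝ, ∀ x ∈ T, Q x ≤ B := by
    have hQ : Continuous Q := by fun_prop
    obtain ⟨B, hB⟩ := (hT.image hQ).bddAbove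
    exact ⟨B, fun x hx => hB ⟨x, hx, rfl⟩⟩
  -- Shrinks the encodings so that their mean square is below `1`, as `layerNorm_preimage` requires.
  let r : ℝ := 1 / (|B| + 1)
  have hB1 : 0 < |B| + 1 := by positivity
  have hr : 0 < r := by positivity
  have hrB : ∀ x ∈ T, r ^ 2 * Q x < 1 := by
    intro x hx
    have h1 : Q x ≤ |B| := (hB x hx).trans (le_abs_self B)
    have h2 : r ^ 2 * Q x = Q x / (|B| + 1) ^ 2 := by simp only [r]; field_simp
    rw [h2, div_lt_one (by positivity)]
    nlinarith [abs_nonneg B]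
  -- The desired normalized token: the scaled values of the `g e`, and in the `true` slot minus
  -- their sum, so that the token is centred. The `false` slot is `i₀`, which will be pinned.
  let ψ' : (Fin d ⊕ Fin N ⊕ Fin N → ℝ) → ι → ℝ := fun x =>
    Sum.elim 0 (Sum.elim (fun e => r * g e x) fun s => if s then -(r * ∑ e, g e x) else 0)
  let ψ : (Fin d ⊕ Fin N ⊕ Fin N → ℝ) → Fin D → ℝ := fun x i => ψ' x (q.symm i)
  have hψc : Continuous ψ := by
    refine continuous_pi fun i => ?_
    change Continuous fun x => ψ' x (q.symm i)
    rcases q.symm i with i | e | s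
    · exact continuous_const
    · exact continuous_const.mul (g e).continuous
    · cases s
      · exact continuous_const
      · exact (continuous_const.mul (continuous_finsetSum _ fun e _ => (g e).continuous)).neg
  have hψ0 : ∀ x, ∑ i, ψ x i = 0 := by
    intro x
    rw [Equiv.sum_comp q.symm (ψ' x)]
    simp [ψ', ι, Fintype.sum_sum_type, ← Finset.mul_sum]
  have hψ2 : ∀ x, ∑ i, ψ x i ^ 2 = r ^ 2 * Q x := by
    intro x
    rw [Equiv.sum_comp q.symm fun i => ψ' x i ^ 2]
    simp [ψ', ι, Q, Fintype.sum_sum_type, ← Finset.mul_sum, mul_pow, mul_add]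
  have hψ1 : ∀ x ∈ T, (∑ i, ψ x i ^ 2) / D < 1 := by
    intro x hx
    rw [hψ2, div_lt_one (by linarith)]
    linarith [hrB x hx]
  let φ : (Fin d ⊕ Fin N ⊕ Fin N → ℝ) → Fin D → ℝ := fun x =>
    Real.sqrt (ε / (1 - (∑ i, ψ x i ^ 2) / D)) • ψ x
  have hφc : ContinuousOn φ T := by
    refine ContinuousOn.smul (Real.continuous_sqrt.comp_continuousOn
      (ContinuousOn.div continuousOn_const (by fun_prop) fun x hx => ?_)) hψc.continuousOn
    exact (sub_pos.2 (hψ1 x hx)).ne'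
  let w : Fin m → Fin D → ℝ := fun e => Pi.single (q (.inr (.inl e))) r⁻¹
  have hw : ∀ e, ∀ x ∈ T, w e ⬝ᵥ pinnedNorm ε i₀ (φ x) = g e x := by
    intro e x hx
    have hne : q (.inr (.inl e)) ≠ i₀ := fun h => nomatch q.injective h
    rw [single_dotProduct, pinnedNorm_of_ne ε hne, layerNorm_preimage hε (hψ0 x) (hψ1 x hx)]
    simp [ψ, ψ', hr.ne']
  -- stability of the read-out
  obtain ⟨δ, hδ, hstab⟩ : ∃ δ > 0, ∀ n ≤ N, ∀ X : Fin n → Fin d ⊕ Fin N ⊕ Fin N → ℝ,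
      (∀ t, X t ∈ T) → ∀ z : Fin n → Fin D → ℝ, (∀ t i, |z t i - φ (X t) i| < δ) →
      |readout ε i₀ w b c n z - readout ε i₀ w b c n fun t => φ (X t)| < η := by
    have hev : ∀ n ∈ Set.Iic N, ∀ᶠ δ in nhdsWithin (0 : ℝ) (Set.Ioi 0),
        ∀ X : Fin n → Fin d ⊕ Fin N ⊕ Fin N → ℝ, (∀ t, X t ∈ T) →
        ∀ z : Fin n → Fin D → ℝ, (∀ t i, |z t i - φ (X t) i| < δ) →
        |readout ε i₀ w b c n z - readout ε i₀ w b c n fun t => φ (X t)| < η := by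
      -- The read-out is uniformly continuous near the compact set of exact encodings, and only
      -- finitely many lengths `n` occur.
      intro n _
      have hcomp : IsCompact (Set.univ.pi fun _ : Fin n => φ '' T) :=
        isCompact_univ_pi fun _ => hT.image_of_continuousOn hφc
      have := hcomp.uniformContinuousAt_of_continuousAt _
        (fun z _ => (continuous_readout hε i₀ w b c n).continuousAt) (Metric.dist_mem_uniformity hη)
      obtain ⟨δ, hδ, h⟩ := Metric.mem_uniformity_dist.1 this
      filter_upwards [Ioo_mem_nhdsGT hδ] with δ' hδ' X hX z hz
      have hdist : dist (fun t => φ (X t)) z < δ := by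
        refine lt_of_le_of_lt ((dist_pi_le_iff hδ'.1.le).2 fun t =>
          (dist_pi_le_iff hδ'.1.le).2 fun i => ?_) hδ'.2
        rw [dist_comm, Real.dist_eq]
        exact (hz t i).le
      have h2 := h hdist fun t _ => ⟨X t, hX t, rfl⟩
      rwa [Set.mem_ofPred_eq, dist_comm, Real.dist_eq] at h2
    have := ((Set.finite_Iic N).eventually_all.2 hev).and self_mem_nhdsWithin
    obtain ⟨δ, h, hδ⟩ := this.exists
    exact ⟨δ, hδ, h⟩
  -- approximation of the node encodings
  obtain ⟨H, _, W, bt, ct, htok⟩ := exists_token_units hε (j := fun i => q (.inl i))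
    (fun i i' h => Sum.inl.inj (q.injective h)) (i₀ := i₀) (i₁ := q (.inr (.inr true)))
    (fun h => nomatch q.injective h) (fun i h => nomatch q.injective h)
    (fun i h => nomatch q.injective h) hT hφc hδ
  refine ⟨twoBlock i₀ (placement fun i => q (.inl i)) W bt ct w b c, fun n hn X hX => ?_⟩
  rw [eval_twoBlock ε i₀ _ W bt ct w b c hn X]
  have h1 := hstab n hn X hX _ fun t i => htok (X t) (hX t) i
  have h2 : readout ε i₀ w b c n (fun t => φ (X t)) =
      (∑ e, c e * (silu (b e + ∑ t, g e (X t)) - silu (b e))) / n := by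
    rw [readout]
    congr 1
    refine Finset.sum_congr rfl fun e _ => ?_
    rw [Finset.sum_congr rfl fun t _ => hw e (X t) (hX t)]
  rwa [h2] at h1

/-! ### Recovering a graph from its node inputs -/

/-- Continuous functions separate finite families of points up to reordering. -/
theorem exists_equiv_of_sum_eq {V : Type*} [TopologicalSpace V] [T1Space V] [NormalSpace V]
    {n n' : ℕ} (x : Fin n → V) (x' : Fin n' → V)
    (h : ∀ g : C(V, ℝ), ∑ v, g (x v) = ∑ v, g (x' v)) :
    ∃ σ : Fin n ≃ Fin n', ∀ v, x' (σ v) = x v := by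
  classical
  have hcard : ∀ p, Fintype.card {v // x v = p} = Fintype.card {v // x' v = p} := by
    intro p
    have hfin : ((Set.range x ∪ Set.range x') \ {p}).Finite :=
      ((Set.finite_range x).union (Set.finite_range x')).sdiff
    -- A Urysohn function isolating `p` among the finitely many points makes both sums count the
    -- multiplicity of `p`.
    obtain ⟨g, hg0, hg1, -⟩ := exists_continuous_zero_one_of_isClosed hfin.isClosed
      (isClosed_singleton (x := p)) Set.disjoint_sdiff_left
    have key : ∀ y ∈ Set.range x ∪ Set.range x', g y = if y = p then 1 else 0 := by
      intro y hy
      split_ifs with hyp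
      · exact hg1 hyp
      · exact hg0 ⟨hy, hyp⟩
    have h1 := h g
    rw [Finset.sum_congr rfl fun v _ => key (x v) (Or.inl ⟨v, rfl⟩),
      Finset.sum_congr rfl fun v _ => key (x' v) (Or.inr ⟨v, rfl⟩),
      Finset.sum_boole, Finset.sum_boole] at h1
    rw [Fintype.card_subtype, Fintype.card_subtype]
    exact_mod_cast h1
  exact ⟨Equiv.ofFiberEquiv fun p => Fintype.equivOfCardEq (hcard p),
    fun v => Equiv.ofFiberEquiv_map _ v⟩

theorem sum_dite_lt {n N : ℕ} (hn : n ≤ N) (f : Fin n → ℝ) :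
    ∑ i : Fin N, (if h : i.val < n then f ⟨i, h⟩ else 0) = ∑ k, f k := by
  have h1 : ∀ k : Fin n, f k = (fun i : ℕ => if h : i < n then f ⟨i, h⟩ else 0) k := by simp
  rw [Finset.sum_congr rfl fun k _ => h1 k,
    ← Finset.sum_range (fun i : ℕ => if h : i < n then f ⟨i, h⟩ else 0),
    ← Finset.sum_range (fun i : ℕ => if h : i < n then f ⟨i, h⟩ else 0)]
  refine (Finset.sum_subset (Finset.range_subset_range.2 hn) fun i _ hi => ?_).symm
  simp_all

section Recover

variable {d N : ℕ} {A B : FeatGraph d}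

theorem FeatGraph.laplacian_of_ne {v w : Fin A.n} (h : v ≠ w) :
    A.laplacian v w = -1 ↔ A.graph.Adj v w := by
  classical
  simp [FeatGraph.laplacian, SimpleGraph.lapMatrix, SimpleGraph.degMatrix, h]

/-- The spectral decomposition of the Laplacian. -/
theorem Eigenfunctions.laplacian_eq (P : Eigenfunctions A) (v w : Fin A.n) :
    A.laplacian v w = ∑ k, P.val k * (P.vec k v * P.vec k w) := by
  let U : Matrix (Fin A.n) (Fin A.n) ℝ := Matrix.of P.vec
  have hU : U * U.transpose = 1 := by
    ext k l
    rw [Matrix.one_apply]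
    exact P.orthonormal k l
  have hU' : U.transpose * U = 1 := mul_eq_one_comm.1 hU
  have h1 : A.laplacian v w = ∑ z, ∑ k, A.laplacian v z * (P.vec k z * P.vec k w) := by
    conv_lhs => rw [← mul_one A.laplacian, ← hU', Matrix.mul_apply]
    exact Finset.sum_congr rfl fun z _ => by rw [Matrix.mul_apply, Finset.mul_sum]; rfl
  rw [h1, Finset.sum_comm]
  refine Finset.sum_congr rfl fun k _ => ?_
  have h2 := congrFun (P.eigen k) v
  simp only [Matrix.mulVec, dotProduct, Pi.smul_apply, smul_eq_mul] at h2
  simp only [← mul_assoc]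
  rw [← Finset.sum_mul, h2]

theorem Eigenfunctions.laplacian_eq_nodeInput (P : Eigenfunctions A) (hA : A.n ≤ N)
    (v w : Fin A.n) : A.laplacian v w = ∑ i : Fin N, A.nodeInput P N v (.inr (.inr i)) *
      (A.nodeInput P N v (.inr (.inl i)) * A.nodeInput P N w (.inr (.inl i))) := by
  rw [P.laplacian_eq, ← sum_dite_lt hA]
  refine Finset.sum_congr rfl fun i _ => ?_
  simp only [FeatGraph.nodeInput, Sum.elim_inr, Sum.elim_inl, pad]
  split_ifs <;> simp

theorem FeatGraph.isIso_of_nodeInput (P : Eigenfunctions A) (Q : Eigenfunctions B) (hA : A.n ≤ N)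
    (hB : B.n ≤ N) (σ : Fin A.n ≃ Fin B.n)
    (h : ∀ v, B.nodeInput Q N (σ v) = A.nodeInput P N v) : A.IsIso B := by
  have hL : ∀ v w, B.laplacian (σ v) (σ w) = A.laplacian v w := by
    intro v w
    rw [Q.laplacian_eq_nodeInput hB, P.laplacian_eq_nodeInput hA, h, h]
  refine ⟨⟨σ, fun {v w} => ?_⟩, fun v => ?_⟩
  · by_cases hvw : v = w
    · simp [hvw]
    · rw [← FeatGraph.laplacian_of_ne hvw, ← hL,
        FeatGraph.laplacian_of_ne (σ.injective.ne hvw)]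
  · funext i
    exact congrFun (h v) (.inl i)

end Recover

/-! ### Compactness of the set of eigenfunctions -/

section Frames

variable {d : ℕ} (A : FeatGraph d)

/-- The orthonormal bases that consist of eigenfunctions. -/
def FeatGraph.frames : Set (Fin A.n → Fin A.n → ℝ) :=
  {u | (∀ k l, u k ⬝ᵥ u l = if k = l then 1 else 0) ∧
    ∀ k, A.laplacian.mulVec (u k) = (u k ⬝ᵥ A.laplacian.mulVec (u k)) • u k}

/-- Writing the eigenvalue as a Rayleigh quotient makes the conditions closed equations in `u`
alone, and orthonormality bounds all entries by `1`. -/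
theorem FeatGraph.isCompact_frames : IsCompact A.frames := by
  have hclosed : IsClosed A.frames := by
    have : A.frames = (⋂ k, ⋂ l, {u | u k ⬝ᵥ u l = if k = l then 1 else 0}) ∩
        ⋂ k, {u | A.laplacian.mulVec (u k) = (u k ⬝ᵥ A.laplacian.mulVec (u k)) • u k} := by
      ext u
      simp [FeatGraph.frames]
    rw [this]
    refine (isClosed_iInter fun k => isClosed_iInter fun l => isClosed_eq ?_ ?_).inter
      (isClosed_iInter fun k => isClosed_eq ?_ ?_) <;> fun_prop
  refine (isCompact_closedBall 0 1).of_isClosed_subset hclosed fun u hu => ?_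
  rw [mem_closedBall_zero_iff, pi_norm_le_iff_of_nonneg zero_le_one]
  intro k
  rw [pi_norm_le_iff_of_nonneg zero_le_one]
  intro v
  have h1 := hu.1 k k
  rw [if_pos rfl, dotProduct] at h1
  have h2 := Finset.single_le_sum (f := fun v => u k v * u k v)
    (fun v _ => mul_self_nonneg _) (Finset.mem_univ v)
  rw [Real.norm_eq_abs]
  exact abs_le_one_iff_mul_self_le_one.2 (by linarith)

/-- The eigenfunctions listed by an orthonormal basis. -/
noncomputable def FeatGraph.ofFrame {u : Fin A.n → Fin A.n → ℝ} (hu : u ∈ A.frames) :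
    Eigenfunctions A where
  vec := u
  val := fun k => u k ⬝ᵥ A.laplacian.mulVec (u k)
  orthonormal := hu.1
  eigen := hu.2

/-- The input of a node in terms of the orthonormal basis. -/
noncomputable def FeatGraph.frameInput (N : ℕ) (v : Fin A.n) (u : Fin A.n → Fin A.n → ℝ) :
    Fin d ⊕ Fin N ⊕ Fin N → ℝ :=
  Sum.elim (A.feat v) (Sum.elim (pad N fun k => u k v)
    (pad N fun k => u k ⬝ᵥ A.laplacian.mulVec (u k)))

theorem FeatGraph.continuous_frameInput (N : ℕ) (v : Fin A.n) :
    Continuous (A.frameInput N v) := by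
  refine continuous_pi fun i => ?_
  rcases i with i | i | i
  · exact continuous_const
  · simp only [FeatGraph.frameInput, Sum.elim_inr, Sum.elim_inl, pad]
    split_ifs <;> fun_prop
  · simp only [FeatGraph.frameInput, Sum.elim_inr, pad]
    split_ifs <;> fun_prop

variable {A}

theorem Eigenfunctions.val_eq (P : Eigenfunctions A) (k : Fin A.n) :
    P.val k = P.vec k ⬝ᵥ A.laplacian.mulVec (P.vec k) := by
  rw [P.eigen, dotProduct_smul, P.orthonormal]
  simp

theorem Eigenfunctions.vec_mem_frames (P : Eigenfunctions A) : P.vec ∈ A.frames :=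
  ⟨P.orthonormal, fun k => by rw [← P.val_eq]; exact P.eigen k⟩

theorem Eigenfunctions.frameInput_vec (P : Eigenfunctions A) (N : ℕ) (v : Fin A.n) :
    A.frameInput N v P.vec = A.nodeInput P N v := by
  simp only [FeatGraph.frameInput, FeatGraph.nodeInput, ← P.val_eq]

end Frames

theorem finite_featGraph {d : ℕ} {F : Set (Fin d → ℝ)} (hF : F.Finite) (N : ℕ) :
    Finite {A : FeatGraph d // A.n ≤ N ∧ ∀ v, A.feat v ∈ F} := by
  have := hF.to_subtype
  let mk : (Σ n : Fin N, SimpleGraph (Fin (n + 1)) × (Fin (n + 1) → F)) →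
      {A : FeatGraph d // A.n ≤ N ∧ ∀ v, A.feat v ∈ F} := fun x =>
    ⟨⟨x.1 + 1, Nat.succ_pos _, x.2.1, fun v => (x.2.2 v).1⟩, x.1.isLt, fun v => (x.2.2 v).2⟩
  refine Finite.of_surjective mk ?_
  rintro ⟨⟨n, hpos, G, feat⟩, hn, hfeat⟩
  obtain ⟨n, rfl⟩ : ∃ k, n = k + 1 := ⟨n - 1, by omega⟩
  exact ⟨⟨⟨n, hn⟩, G, fun v => ⟨feat v, hfeat v⟩⟩, rfl⟩

/-! ### Universality of Graph Mamba networks on isomorphism classes -/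

/-- A function that is constant on the pieces of a finite closed cover is continuous. -/
theorem exists_continuous_of_finite_cover {Z ι : Type*} [TopologicalSpace Z] [Finite ι]
    {S : ι → Set Z} (hS : ∀ i, IsClosed (S i)) (val : ι → ℝ)
    (hval : ∀ i j, (S i ∩ S j).Nonempty → val i = val j) :
    ∃ ρ : C(⋃ i, S i, ℝ), ∀ i, ∀ z : (⋃ i, S i : Set Z), z.1 ∈ S i → ρ z = val i := by
  choose idx hidx using fun z : (⋃ i, S i : Set Z) => Set.mem_iUnion.1 z.2
  have hρ : ∀ i, ∀ z : (⋃ i, S i : Set Z), z.1 ∈ S i → val (idx z) = val i := fun i z hz =>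
    hval _ _ ⟨z.1, hidx z, hz⟩
  refine ⟨⟨fun z => val (idx z), ?_⟩, hρ⟩
  refine (locallyFinite_of_finite fun i => ((↑) : (⋃ i, S i : Set Z) → Z) ⁻¹' S i).continuous
    (Set.eq_univ_of_forall fun z => Set.mem_iUnion.2 ⟨idx z, hidx z⟩)
    (fun i => (hS i).preimage continuous_subtype_val) fun i => ?_
  exact continuousOn_const.congr (hρ i)

/-- Graph Mamba networks approximate all isomorphism invariants of graphs of bounded size with
features from a finite set. -/
theorem exists_gmn_near_invariant {ε : ℝ} (hε : 0 < ε) {d : ℕ} {F : Set (Fin d → ℝ)}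
    (hF : F.Finite) (N : ℕ) (f : FeatGraph d → ℝ)
    (hf : ∀ A B : FeatGraph d, A.n ≤ N → B.n ≤ N → (∀ v, A.feat v ∈ F) → (∀ v, B.feat v ∈ F) →
      A.IsIso B → f A = f B) {η : ℝ} (hη : 0 < η) :
    ∃ G : GMN d N, ∀ A : FeatGraph d, A.n ≤ N → (∀ v, A.feat v ∈ F) →
      ∀ a ∈ G.outputs ε A, |a - f A| < η := by
  have := finite_featGraph hF N
  let 𝒢 := {A : FeatGraph d // A.n ≤ N ∧ ∀ v, A.feat v ∈ F}
  let V := Fin d ⊕ Fin N ⊕ Fin N → ℝ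
  let T : Set V := ⋃ A : 𝒢, ⋃ v, A.1.frameInput N v '' A.1.frames
  have hT : IsCompact T := isCompact_iUnion fun A => isCompact_iUnion fun v =>
    A.1.isCompact_frames.image (A.1.continuous_frameInput N v)
  -- a graph is recorded by the sums of all continuous functions over its node inputs
  let nodeSum : (A : FeatGraph d) → (Fin A.n → Fin A.n → ℝ) → C(V, ℝ) → ℝ := fun A u g =>
    ∑ v, g (A.frameInput N v u)
  -- The extra piece `{0}`, with value `0`, controls the constants `silu (b e)` that the node block
  -- subtracts. The other values carry the factor `A.n` because the network averages over the nodes.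
  let S : Option 𝒢 → Set (C(V, ℝ) → ℝ) := fun o => o.elim {0} fun A => nodeSum A.1 '' A.1.frames
  let val : Option 𝒢 → ℝ := fun o => o.elim 0 fun A => A.1.n * f A.1
  have hScomp : ∀ o, IsCompact (S o) := by
    rintro (_ | A)
    · exact isCompact_singleton
    · exact A.1.isCompact_frames.image (continuous_pi fun g =>
        continuous_finsetSum _ fun v _ => g.continuous.comp (A.1.continuous_frameInput N v))
  have hone : ∀ (A : FeatGraph d) u, nodeSum A u 1 = A.n := fun A u => by simp [nodeSum]
  have hval : ∀ o o', (S o ∩ S o').Nonempty → val o = val o' := by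
    rintro (_ | A) (_ | B) ⟨y, hy, hy'⟩
    · rfl
    · obtain ⟨u, -, rfl⟩ := hy'
      have h1 := congrFun (Set.mem_singleton_iff.1 hy) 1
      rw [hone] at h1
      exact absurd h1 (Nat.cast_ne_zero.2 B.1.n_pos.ne')
    · obtain ⟨u, -, rfl⟩ := hy
      have h1 := congrFun (Set.mem_singleton_iff.1 hy') 1
      rw [hone] at h1
      exact absurd h1 (Nat.cast_ne_zero.2 A.1.n_pos.ne')
    · obtain ⟨u, hu, rfl⟩ := hy
      obtain ⟨u', hu', he⟩ := hy'
      obtain ⟨σ, hσ⟩ := exists_equiv_of_sum_eq (fun v => A.1.frameInput N v u)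
        (fun v => B.1.frameInput N v u') fun g => (congrFun he g).symm
      have hiso : A.1.IsIso B.1 := FeatGraph.isIso_of_nodeInput (A.1.ofFrame hu) (B.1.ofFrame hu')
        A.2.1 B.2.1 σ hσ
      have hn : A.1.n = B.1.n := by simpa using Fintype.card_congr σ
      simp only [val, Option.elim, hf A.1 B.1 A.2.1 B.2.1 A.2.2 B.2.2 hiso, hn]
  obtain ⟨ρ, hρ⟩ := exists_continuous_of_finite_cover (fun o => (hScomp o).isClosed) val hval
  let Y : Set (C(V, ℝ) → ℝ) := ⋃ o, S o
  have : CompactSpace Y := isCompact_iff_compactSpace.1 (isCompact_iUnion hScomp)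
  have hadd : ∀ y : Y, y.1 0 = 0 ∧ ∀ g g', y.1 (g + g') = y.1 g + y.1 g' := by
    rintro ⟨y, hy⟩
    obtain ⟨_ | A, hA⟩ := Set.mem_iUnion.1 hy
    · obtain rfl : y = 0 := hA
      simp
    · obtain ⟨u, -, rfl⟩ := hA
      simp [nodeSum, Finset.sum_add_distrib]
  let ev : C(V, ℝ) → C(Y, ℝ) := fun g => ⟨fun y => y.1 g,
    (continuous_apply g).comp continuous_subtype_val⟩
  let L : AddSubmonoid C(Y, ℝ) :=
    { carrier := Set.range ev
      zero_mem' := ⟨0, by ext y; exact (hadd y).1⟩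
      add_mem' := by
        rintro _ _ ⟨g, rfl⟩ ⟨g', rfl⟩
        exact ⟨g + g', by ext y; exact (hadd y).2 g g'⟩ }
  obtain ⟨m, c, b, l, hl, happ⟩ := exists_silu_sum_near L (fun y y' hne => by
    by_contra! hcon
    exact hne (Subtype.ext (funext fun g => hcon (ev g) ⟨g, rfl⟩))) ρ (η := η / 3) (by linarith)
  choose g hg using hl
  obtain ⟨G, hG⟩ := exists_gmn_near hε hT b c g (η := η / 3) (by linarith)
  refine ⟨G, fun A hA hAF => ?_⟩
  rintro _ ⟨P, π, rfl⟩
  let A' : 𝒢 := ⟨A, hA, hAF⟩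
  have h1 := hG A.n hA (fun t => A.nodeInput P N (π t)) fun t => Set.mem_iUnion.2 ⟨A',
    Set.mem_iUnion.2 ⟨π t, P.vec, P.vec_mem_frames, P.frameInput_vec N _⟩⟩
  have hsum : ∀ e, ∑ t, g e (A.nodeInput P N (π t)) = nodeSum A P.vec (g e) := fun e => by
    rw [Equiv.sum_comp π fun v => g e (A.nodeInput P N v)]
    simp only [nodeSum, P.frameInput_vec]
  simp only [hsum] at h1
  have hyA : nodeSum A P.vec ∈ S (some A') := ⟨P.vec, P.vec_mem_frames, rfl⟩
  have h2 := happ ⟨nodeSum A P.vec, Set.mem_iUnion.2 ⟨_, hyA⟩⟩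
  have hy0 : (0 : C(V, ℝ) → ℝ) ∈ S none := Set.mem_singleton 0
  have h3 := happ ⟨0, Set.mem_iUnion.2 ⟨_, hy0⟩⟩
  rw [hρ (some A') _ hyA] at h2
  rw [hρ none _ hy0] at h3
  simp only [← hg, ev, ContinuousMap.coe_mk, Pi.zero_apply, add_zero] at h2 h3
  have hn : (1 : ℝ) ≤ A.n := by exact_mod_cast A.n_pos
  -- The approximant at the record of `A` minus the approximant at `0`, each with its own error.
  have hdiff : ∑ e, c e * (silu (b e + nodeSum A P.vec (g e)) - silu (b e)) - A.n * f A =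
      (∑ e, c e * silu (b e + nodeSum A P.vec (g e)) - val (some A')) -
        (∑ e, c e * silu (b e) - val none) := by
    simp only [mul_sub, Finset.sum_sub_distrib, val, Option.elim, A']
    ring
  have h4 : |(∑ e, c e * (silu (b e + nodeSum A P.vec (g e)) - silu (b e))) / A.n - f A| <
      η / 3 + η / 3 := by
    have h5 : (∑ e, c e * (silu (b e + nodeSum A P.vec (g e)) - silu (b e))) / A.n - f A =
        (∑ e, c e * (silu (b e + nodeSum A P.vec (g e)) - silu (b e)) - A.n * f A) / A.n := by
      field_simp
    rw [h5, abs_div, abs_of_pos (by linarith : (0 : ℝ) < A.n)]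
    refine (div_le_self (abs_nonneg _) hn).trans_lt ?_
    rw [hdiff]
    exact (abs_sub _ _).trans_lt (add_lt_add h2 h3)
  calc _ ≤ _ := abs_sub_le _ _ _
    _ < η / 3 + (η / 3 + η / 3) := add_lt_add h1 h4
    _ = η := by ring

section Iso

variable {d : ℕ}

theorem FeatGraph.IsIso.refl (A : FeatGraph d) : A.IsIso A := ⟨SimpleGraph.Iso.refl, fun _ => rfl⟩

theorem FeatGraph.IsIso.symm {A B : FeatGraph d} : A.IsIso B → B.IsIso A := by
  rintro ⟨e, he⟩
  exact ⟨e.symm, fun v => by rw [← he, RelIso.apply_symm_apply]⟩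

theorem FeatGraph.IsIso.trans {A B C : FeatGraph d} : A.IsIso B → B.IsIso C → A.IsIso C := by
  rintro ⟨e, he⟩ ⟨e', he'⟩
  exact ⟨e.trans e', fun v => by rw [← he, ← he']; rfl⟩

end Iso

/-- A single network separates all isomorphism classes. -/
theorem exists_gmn_separating {ε : ℝ} (hε : 0 < ε) {d : ℕ} {F : Set (Fin d → ℝ)}
    (hF : F.Finite) (N : ℕ) {δ : ℝ} (hδ : 0 < δ) :
    ∃ g : GMN d N, ∀ A B : FeatGraph d, A.n ≤ N → B.n ≤ N → (∀ v, A.feat v ∈ F) →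
      (∀ v, B.feat v ∈ F) →
      (A.IsIso B → ∀ a ∈ g.outputs ε A, ∀ b ∈ g.outputs ε B, |a - b| < δ) ∧
      (¬ A.IsIso B → g.Distinguishes ε A B ∧
        ∀ a ∈ g.outputs ε A, ∀ b ∈ g.outputs ε B, 1 ≤ |a - b|) := by
  classical
  have := finite_featGraph hF N
  let 𝒢 := {A : FeatGraph d // A.n ≤ N ∧ ∀ v, A.feat v ∈ F}
  let iso : Setoid 𝒢 := ⟨fun A B => A.1.IsIso B.1, fun A => .refl _, .symm, .trans⟩
  obtain ⟨k, ⟨q⟩⟩ := Finite.exists_equiv_fin (Quotient iso)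
  -- Values of different classes are at least `2` apart, so errors below `1 / 2` leave a gap of at
  -- least `1`.
  let f : FeatGraph d → ℝ := fun A =>
    if h : A.n ≤ N ∧ ∀ v, A.feat v ∈ F then 2 * ((q ⟦⟨A, h⟩⟧ : Fin k) : ℕ) else 0
  have hf : ∀ A B : FeatGraph d, A.n ≤ N → B.n ≤ N → (∀ v, A.feat v ∈ F) →
      (∀ v, B.feat v ∈ F) → A.IsIso B → f A = f B := by
    intro A B hA hB hAF hBF h
    simp only [f]
    rw [dif_pos ⟨hA, hAF⟩, dif_pos ⟨hB, hBF⟩]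
    have : (⟦⟨A, hA, hAF⟩⟧ : Quotient iso) = ⟦⟨B, hB, hBF⟩⟧ := Quotient.sound h
    rw [this]
  have hf' : ∀ A B : FeatGraph d, A.n ≤ N → B.n ≤ N → (∀ v, A.feat v ∈ F) →
      (∀ v, B.feat v ∈ F) → ¬ A.IsIso B → f A + 2 ≤ f B ∨ f B + 2 ≤ f A := by
    intro A B hA hB hAF hBF h
    simp only [f]
    rw [dif_pos ⟨hA, hAF⟩, dif_pos ⟨hB, hBF⟩]
    have hne : (q ⟦⟨A, hA, hAF⟩⟧ : ℕ) ≠ q ⟦⟨B, hB, hBF⟩⟧ := fun he =>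
      h (Quotient.exact (q.injective (Fin.ext he)))
    rcases Nat.lt_or_gt_of_ne hne with hlt | hlt
    · left
      have : ((q ⟦⟨A, hA, hAF⟩⟧ : ℕ) : ℝ) + 1 ≤ (q ⟦⟨B, hB, hBF⟩⟧ : ℕ) := by exact_mod_cast hlt
      linarith
    · right
      have : ((q ⟦⟨B, hB, hBF⟩⟧ : ℕ) : ℝ) + 1 ≤ (q ⟦⟨A, hA, hAF⟩⟧ : ℕ) := by exact_mod_cast hlt
      linarith
  obtain ⟨g, hg⟩ := exists_gmn_near_invariant hε hF N f hf
    (η := min (δ / 2) (1 / 2)) (by positivity)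
  refine ⟨g, fun A B hA hB hAF hBF => ⟨fun h a ha b hb => ?_, fun h => ⟨?_, fun a ha b hb => ?_⟩⟩⟩
  · have h1 := abs_lt.1 ((hg A hA hAF a ha).trans_le (min_le_left _ _))
    have h2 := abs_lt.1 ((hg B hB hBF b hb).trans_le (min_le_left _ _))
    rw [hf A B hA hB hAF hBF h] at h1
    exact abs_lt.2 ⟨by linarith, by linarith⟩
  · have h1 := fun a ha => abs_lt.1 ((hg A hA hAF a ha).trans_le (min_le_right _ _))
    have h2 := fun b hb => abs_lt.1 ((hg B hB hBF b hb).trans_le (min_le_right _ _))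
    rcases hf' A B hA hB hAF hBF h with h3 | h3
    · exact ⟨f A + 1, .inl ⟨fun a ha => by linarith [(h1 a ha).2], fun b hb => by
        linarith [(h2 b hb).1]⟩⟩
    · exact ⟨f B + 1, .inr ⟨fun a ha => by linarith [(h1 a ha).1], fun b hb => by
        linarith [(h2 b hb).2]⟩⟩
  · have h1 := abs_lt.1 ((hg A hA hAF a ha).trans_le (min_le_right _ _))
    have h2 := abs_lt.1 ((hg B hB hBF b hb).trans_le (min_le_right _ _))
    rcases hf' A B hA hB hAF hBF h with h3 | h3
    · exact le_abs.2 (.inr (by linarith))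
    · exact le_abs.2 (.inl (by linarith))

/-! ### Bisimulations and the Weisfeiler-Lehman tests -/

/-- `R` is a winning strategy for Duplicator in the bijective pebble game: the bijection `β` matches
the multisets added in each round, by induction on rounds. -/
theorem wlColor_eq_of_bisim {d k : ℕ} {A B : FeatGraph d}
    (R : (Fin k → Fin A.n) → (Fin k → Fin B.n) → Prop)
    (hatom : ∀ v v', R v v' → atomicType A v = atomicType B v')
    (hstep : ∀ v v', R v v' → ∃ β : Fin A.n ≃ Fin B.n, ∀ w,
      atomicType A (Fin.snoc (α := fun _ => Fin A.n) v w) =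
        atomicType B (Fin.snoc (α := fun _ => Fin B.n) v' (β w)) ∧
      ∀ i, R (Function.update v i w) (Function.update v' i (β w))) (t : ℕ) :
    ∀ v v', R v v' → wlColor k A t v = wlColor k B t v' := by
  induction t with
  | zero => exact hatom
  | succ t ih =>
    intro v v' h
    obtain ⟨β, hβ⟩ := hstep v v' h
    refine Prod.ext (ih v v' h) ?_
    have huniv : (Finset.univ : Finset (Fin B.n)).val =
        (Finset.univ : Finset (Fin A.n)).val.map β := by
      rw [← Finset.map_univ_equiv β]
      rfl
    change (Finset.univ.val.map fun w =>
        (atomicType A (Fin.snoc (α := fun _ => Fin A.n) v w),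
          fun i => wlColor k A t (Function.update v i w))) =
      Finset.univ.val.map fun w =>
        (atomicType B (Fin.snoc (α := fun _ => Fin B.n) v' w),
          fun i => wlColor k B t (Function.update v' i w))
    rw [huniv, Multiset.map_map]
    refine Multiset.map_congr rfl fun w _ => Prod.ext (hβ w).1 (funext fun i => ?_)
    exact ih _ _ ((hβ w).2 i)

theorem not_wlDistinguishes_of_bisim {d k : ℕ} {A B : FeatGraph d}
    (R : (Fin k → Fin A.n) → (Fin k → Fin B.n) → Prop)
    (hatom : ∀ v v', R v v' → atomicType A v = atomicType B v')
    (hstep : ∀ v v', R v v' → ∃ β : Fin A.n ≃ Fin B.n, ∀ w,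
      atomicType A (Fin.snoc (α := fun _ => Fin A.n) v w) =
        atomicType B (Fin.snoc (α := fun _ => Fin B.n) v' (β w)) ∧
      ∀ i, R (Function.update v i w) (Function.update v' i (β w)))
    (θ : (Fin k → Fin A.n) ≃ (Fin k → Fin B.n)) (hθ : ∀ v, R v (θ v)) :
    ¬ WLDistinguishes k A B := by
  rintro ⟨t, ht⟩
  apply ht
  have huniv : (Finset.univ : Finset (Fin k → Fin B.n)).val =
      (Finset.univ : Finset (Fin k → Fin A.n)).val.map θ := by
    rw [← Finset.map_univ_equiv θ]
    rfl
  rw [huniv, Multiset.map_map]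
  exact Multiset.map_congr rfl fun v _ => wlColor_eq_of_bisim R hatom hstep t v _ (hθ v)

theorem FeatGraph.IsIso.not_wlDistinguishes {d k : ℕ} {A B : FeatGraph d} (h : A.IsIso B) :
    ¬ WLDistinguishes k A B := by
  obtain ⟨e, he⟩ := h
  have hatom : ∀ {j : ℕ} (v : Fin j → Fin A.n), atomicType A v = atomicType B (e ∘ v) := by
    intro j v
    simp [atomicType, he, ← SimpleGraph.Iso.map_adj_iff e]
  refine not_wlDistinguishes_of_bisim (fun v v' => v' = e ∘ v) ?_ ?_
    (Equiv.arrowCongr (Equiv.refl _) e.toEquiv) fun v => rfl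
  · rintro v _ rfl
    exact hatom v
  · rintro v _ rfl
    refine ⟨e.toEquiv, fun w => ⟨?_, fun i => ?_⟩⟩
    · rw [hatom]
      congr 1
      exact Fin.comp_snoc e v w
    · exact (Function.comp_update e v i w).symm

/-! ### Plain graphs as graphs with constant features -/

section OfGraph

variable {d k : ℕ} {V V' : Type} [Fintype V] [Nonempty V] [Fintype V'] [Nonempty V']

/-- A finite graph, with the same feature vector at all vertices. -/
noncomputable def FeatGraph.ofGraph (G : SimpleGraph V) (x : Fin d → ℝ) : FeatGraph d where
  n := Fintype.card V
  n_pos := Fintype.card_pos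
  graph := G.comap (Fintype.equivFin V).symm
  feat := fun _ => x

theorem FeatGraph.nonempty_iso_of_isIso {G : SimpleGraph V} {G' : SimpleGraph V'} {x : Fin d → ℝ}
    (h : (FeatGraph.ofGraph G x).IsIso (FeatGraph.ofGraph G' x)) : Nonempty (G ≃g G') := by
  obtain ⟨e, -⟩ := h
  exact ⟨(SimpleGraph.Iso.comap (Fintype.equivFin V).symm G).symm.trans
    (e.trans (SimpleGraph.Iso.comap (Fintype.equivFin V').symm G'))⟩

/-- Two tuples of vertices have the same equalities and adjacencies. -/
def SameType (G : SimpleGraph V) (G' : SimpleGraph V') (v : Fin k → V) (v' : Fin k → V') : Prop :=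
  ∀ i j, (v i = v j ↔ v' i = v' j) ∧ (G.Adj (v i) (v j) ↔ G'.Adj (v' i) (v' j))

theorem not_wlDistinguishes_ofGraph {G : SimpleGraph V} {G' : SimpleGraph V'} (x : Fin d → ℝ)
    (R : (Fin k → V) → (Fin k → V') → Prop)
    (hatom : ∀ v v', R v v' → SameType G G' v v')
    (hstep : ∀ v v', R v v' → ∃ β : V ≃ V', ∀ w,
      SameType G G' (Fin.snoc (α := fun _ => V) v w) (Fin.snoc (α := fun _ => V') v' (β w)) ∧
      ∀ i, R (Function.update v i w) (Function.update v' i (β w)))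
    (θ : (Fin k → V) ≃ (Fin k → V')) (hθ : ∀ v, R v (θ v)) :
    ¬ WLDistinguishes k (FeatGraph.ofGraph G x) (FeatGraph.ofGraph G' x) := by
  let e : Fin (FeatGraph.ofGraph G x).n ≃ V := (Fintype.equivFin V).symm
  let e' : Fin (FeatGraph.ofGraph G' x).n ≃ V' := (Fintype.equivFin V').symm
  have htype : ∀ {j : ℕ} (v : Fin j → Fin (FeatGraph.ofGraph G x).n)
      (v' : Fin j → Fin (FeatGraph.ofGraph G' x).n), SameType G G' (e ∘ v) (e' ∘ v') →
      atomicType (FeatGraph.ofGraph G x) v = atomicType (FeatGraph.ofGraph G' x) v' := by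
    intro j v v' h
    refine Prod.ext (funext fun i => funext fun l => propext ?_)
      (Prod.ext (funext fun i => funext fun l => propext ?_) rfl)
    · change v i = v l ↔ v' i = v' l
      simpa using (h i l).1
    · exact (h i l).2
  refine not_wlDistinguishes_of_bisim (fun v v' => R (e ∘ v) (e' ∘ v'))
    (fun v v' h => htype v v' (hatom _ _ h)) (fun v v' h => ?_)
    ((Equiv.arrowCongr (Equiv.refl _) e).trans
      (θ.trans (Equiv.arrowCongr (Equiv.refl _) e'.symm))) fun v => ?_
  · obtain ⟨β, hβ⟩ := hstep _ _ h
    refine ⟨e.trans (β.trans e'.symm), fun w => ⟨htype _ _ ?_, fun i => ?_⟩⟩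
    · have := (hβ (e w)).1
      rw [Fin.comp_snoc, Fin.comp_snoc]
      simpa using this
    · have := (hβ (e w)).2 i
      rw [Function.comp_update, Function.comp_update]
      simpa using this
  · have : e' ∘ (e'.symm ∘ θ (e ∘ v)) = θ (e ∘ v) := by
      rw [← Function.comp_assoc, Equiv.self_comp_symm, Function.id_comp]
    change R (e ∘ v) (e' ∘ (e'.symm ∘ θ (e ∘ v)))
    rw [this]
    exact hθ _

end OfGraph

/-! ### Cai-Fürer-Immerman graphs over complete graphs -/

section CFI

variable {m : ℕ}

/-- Vertices of the Cai-Fürer-Immerman graph over the complete graph on `Fin m` with twist `τ`: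
a base vertex `a` and a set of edges at `a`, of parity `τ a`. -/
abbrev CFIVertex (τ : Fin m → ZMod 2) : Type :=
  {p : Fin m × (Fin m → ZMod 2) // p.2 p.1 = 0 ∧ ∑ b, p.2 b = τ p.1}

/-- The Cai-Fürer-Immerman graph: vertices over distinct base vertices are adjacent if they agree
on the edge between these. -/
def cfiGraph (τ : Fin m → ZMod 2) : SimpleGraph (CFIVertex τ) where
  Adj v w := v.1.1 ≠ w.1.1 ∧ v.1.2 w.1.1 = w.1.2 v.1.1
  symm := ⟨fun _ _ h => ⟨h.1.symm, h.2.symm⟩⟩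
  loopless := ⟨fun _ h => h.1 rfl⟩

theorem cfiVertex_nonempty [Nontrivial (Fin m)] (τ : Fin m → ZMod 2) : Nonempty (CFIVertex τ) := by
  obtain ⟨a, b, hab⟩ := exists_pair_ne (Fin m)
  exact ⟨⟨(a, Pi.single b (τ a)), by simp [hab], by simp⟩⟩

theorem sum_eq_zero_of_symm {h : Fin m → Fin m → ZMod 2} (hsymm : ∀ a b, h a b = h b a)
    (hdiag : ∀ a, h a a = 0) : ∑ a, ∑ b, h a b = 0 := by
  rw [← Fintype.sum_prod_type']
  refine Finset.sum_involution (fun p _ => (p.2, p.1)) (fun p _ => ?_) (fun p _ hp he => ?_)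
    (fun _ _ => Finset.mem_univ _) fun _ _ => rfl
  · rw [hsymm p.2 p.1, CharTwo.add_self_eq_zero]
  · have : p.1 = p.2 := congrArg Prod.snd he
    exact hp (by rw [this, hdiag])

/-- A twisted graph has no clique that meets all base vertices. -/
theorem cfiGraph_not_iso {τ : Fin m → ZMod 2} (hτ : ∑ a, τ a ≠ 0) :
    IsEmpty (cfiGraph (0 : Fin m → ZMod 2) ≃g cfiGraph τ) := by
  refine ⟨fun e => hτ ?_⟩
  -- The zero vertices form a clique over all base vertices. Its image picks one vertex in each
  -- fibre, and adjacency makes their edge sets a symmetric matrix with row sums `τ`, so `τ` sums to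
  -- zero modulo 2.
  let f : Fin m → CFIVertex τ := fun a => e ⟨(a, 0), by simp, by simp⟩
  have hf : ∀ a b, a ≠ b → (cfiGraph τ).Adj (f a) (f b) := fun a b hab =>
    e.map_rel_iff.2 ⟨hab, rfl⟩
  have hinj : Function.Injective fun a => (f a).1.1 := fun a b hab => by
    by_contra hne
    exact (hf a b hne).1 hab
  let σ : Fin m ≃ Fin m := Equiv.ofBijective _ (Finite.injective_iff_bijective.1 hinj)
  have hσ : ∀ a, (f (σ.symm a)).1.1 = a := fun a => σ.apply_symm_apply a
  let h : Fin m → Fin m → ZMod 2 := fun a b => (f (σ.symm a)).1.2 b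
  have hrow : ∀ a, ∑ b, h a b = τ a := fun a => by
    rw [(f (σ.symm a)).2.2, hσ]
  have hdiag : ∀ a, h a a = 0 := fun a => by
    have := (f (σ.symm a)).2.1
    rwa [hσ] at this
  have hsymm : ∀ a b, h a b = h b a := by
    intro a b
    by_cases hab : a = b
    · rw [hab]
    · have := (hf _ _ (σ.symm.injective.ne hab)).2
      rwa [hσ, hσ] at this
  rw [← sum_eq_zero_of_symm hsymm hdiag]
  exact Finset.sum_congr rfl fun a _ => (hrow a).symm

variable {τ τ' : Fin m → ZMod 2}

/-- Flipping the edges `r a` at the base vertices `a`. -/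
def cfiShift (r : Fin m → Fin m → ZMod 2) (h0 : ∀ a, r a a = 0)
    (hr : ∀ a, ∑ b, r a b = τ a + τ' a) : CFIVertex τ ≃ CFIVertex τ' where
  toFun v := ⟨(v.1.1, v.1.2 + r v.1.1), by simp [h0, v.2.1], by
    simp only [Pi.add_apply, Finset.sum_add_distrib, v.2.2, hr]
    rw [← add_assoc, CharTwo.add_self_eq_zero, zero_add]⟩
  invFun v := ⟨(v.1.1, v.1.2 + r v.1.1), by simp [h0, v.2.1], by
    simp only [Pi.add_apply, Finset.sum_add_distrib, v.2.2, hr]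
    rw [add_comm (τ _), ← add_assoc, CharTwo.add_self_eq_zero, zero_add]⟩
  left_inv v := by
    refine Subtype.ext (Prod.ext rfl (funext fun b => ?_))
    simp only [Pi.add_apply, add_assoc, CharTwo.add_self_eq_zero, add_zero]
  right_inv v := by
    refine Subtype.ext (Prod.ext rfl (funext fun b => ?_))
    simp only [Pi.add_apply, add_assoc, CharTwo.add_self_eq_zero, add_zero]

/-- Flipping the edges marked by `y` turns the twist `τ` into `τ'` except possibly at `a₀`. -/
structure IsFlip (τ τ' : Fin m → ZMod 2) (a₀ : Fin m) (y : Fin m → Fin m → ZMod 2) : Prop where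
  symm : ∀ a b, y a b = y b a
  diag : ∀ a, y a a = 0
  sum : ∀ a, a ≠ a₀ → ∑ b, y a b = τ a + τ' a

/-- The vertex `w` lies outside the fibre of `a₀`, and flipping the edges marked by `y` turns it
into `w'`. -/
def FlipsTo (a₀ : Fin m) (y : Fin m → Fin m → ZMod 2) (w : CFIVertex τ) (w' : CFIVertex τ') :
    Prop :=
  w.1.1 ≠ a₀ ∧ w'.1 = (w.1.1, w.1.2 + y w.1.1)

/-- A flip translates each fibre, and by symmetry of `y` it changes both ends of an edge by the same
amount. -/
theorem sameType_of_flip {k : ℕ} {a₀ : Fin m} {y : Fin m → Fin m → ZMod 2}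
    (hy : IsFlip τ τ' a₀ y) {v : Fin k → CFIVertex τ} {v' : Fin k → CFIVertex τ'}
    (h : ∀ i, FlipsTo a₀ y (v i) (v' i)) : SameType (cfiGraph τ) (cfiGraph τ') v v' := by
  intro i j
  constructor
  · rw [Subtype.ext_iff, Subtype.ext_iff, (h i).2, (h j).2, Prod.ext_iff, Prod.ext_iff]
    refine and_congr_right fun h1 => ?_
    simp only [h1, add_left_inj]
  · simp only [cfiGraph, (h i).2, (h j).2, Pi.add_apply]
    rw [hy.symm (v j).1.1 (v i).1.1, add_left_inj]

/-- Duplicator's answer when the free base vertex is `a₀` and `b₀` is another one. -/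
theorem exists_flip_answer {k : ℕ} {a₀ b₀ : Fin m} (hab : b₀ ≠ a₀)
    {y : Fin m → Fin m → ZMod 2} (hy : IsFlip τ τ' a₀ y) {v : Fin k → CFIVertex τ}
    {v' : Fin k → CFIVertex τ'} (h : ∀ i, FlipsTo a₀ y (v i) (v' i)) (hb : ∀ i, (v i).1.1 ≠ b₀) :
    ∃ β : CFIVertex τ ≃ CFIVertex τ', ∀ w, ∃ a₁ y₁, IsFlip τ τ' a₁ y₁ ∧
      (∀ i, FlipsTo a₁ y₁ (v i) (v' i)) ∧ FlipsTo a₁ y₁ w (β w) := by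
  -- The parity defect at `a₀`. Adding it on the edge from `a₀` to `b₀` repairs `a₀` and moves the
  -- possible defect to `b₀`.
  let c := τ a₀ + τ' a₀ + ∑ b, y a₀ b
  let y' : Fin m → Fin m → ZMod 2 := fun a b =>
    y a b + if (a = a₀ ∧ b = b₀) ∨ (a = b₀ ∧ b = a₀) then c else 0
  have hrow : ∀ a, a ≠ a₀ → a ≠ b₀ → y' a = y a := fun a h1 h2 => by
    funext b
    simp [y', h1, h2]
  have hsum : ∑ b, y' a₀ b = τ a₀ + τ' a₀ := by
    simp only [y', Finset.sum_add_distrib, hab.symm, false_and, or_false, true_and,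
      Finset.sum_ite_eq', Finset.mem_univ, if_true, c]
    rw [add_comm, add_assoc, CharTwo.add_self_eq_zero, add_zero]
  have hdiag : ∀ a, y' a a = 0 := fun a => by
    have : ¬((a = a₀ ∧ a = b₀) ∨ (a = b₀ ∧ a = a₀)) := by
      rintro (⟨rfl, h2⟩ | ⟨rfl, h2⟩)
      · exact hab h2.symm
      · exact hab h2
    simp [y', hy.diag, this]
  have hy' : IsFlip τ τ' b₀ y' := by
    refine ⟨fun a b => ?_, hdiag, fun a ha => ?_⟩
    · simp only [y', hy.symm a b]
      congr 2
      exact propext ⟨by tauto, by tauto⟩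
    · by_cases haa : a = a₀
      · rw [haa, hsum]
      · rw [hrow a haa ha, hy.sum a haa]
  -- Only a new pebble in the fibre of `a₀` forces the defect to move; `y` and `y'` agree on the
  -- fibres already pebbled, which avoid both `a₀` and `b₀`.
  refine ⟨cfiShift (fun a => if a = a₀ then y' a else y a) (fun a => ?_) (fun a => ?_), fun w => ?_⟩
  · split_ifs
    · exact hdiag a
    · exact hy.diag a
  · split_ifs with haa
    · rw [haa, hsum]
    · exact hy.sum a haa
  · by_cases hw : w.1.1 = a₀
    · refine ⟨b₀, y', hy', fun i => ⟨hb i, ?_⟩, fun he => hab (he.symm.trans hw), ?_⟩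
      · rw [(h i).2, hrow _ (h i).1 (hb i)]
      · simp [cfiShift, hw]
    · exact ⟨a₀, y, hy, h, hw, by simp [cfiShift, hw]⟩

theorem exists_notMem_range {j : ℕ} (hj : j < m) (p : Fin j → Fin m) : ∃ a, ∀ i, p i ≠ a := by
  by_contra! hcon
  have := Fintype.card_le_of_surjective p hcon
  simp at this
  omega

/-- The Cai-Fürer-Immerman graphs over a complete graph with at least `k + 2` vertices are not
distinguished by the `k`-dimensional Weisfeiler-Lehman test, whatever the twists. -/
theorem cfiGraph_not_wlDistinguishes {d k : ℕ} (hk : k + 1 < m) [Nonempty (CFIVertex τ)]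
    [Nonempty (CFIVertex τ')] (x : Fin d → ℝ) :
    ¬ WLDistinguishes k (FeatGraph.ofGraph (cfiGraph τ) x)
      (FeatGraph.ofGraph (cfiGraph τ') x) := by
  choose free hfree using exists_notMem_range (m := m) (j := k) (by omega)
  have hm : ∀ a : Fin m, ∃ b, a ≠ b := fun a => by
    obtain ⟨b, hb⟩ := exists_notMem_range (m := m) (j := 1) (by omega) fun _ => a
    exact ⟨b, hb 0⟩
  choose other hother using hm
  -- Every base vertex corrects its parity on its edge to the free vertex `a₀`. The row of `a₀`
  -- itself only serves to make the shift a bijection on all vertices.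
  let r : Fin m → Fin m → Fin m → ZMod 2 := fun a₀ a =>
    if a = a₀ then Pi.single (other a₀) (τ a + τ' a) else Pi.single a₀ (τ a + τ' a)
  have hr0 : ∀ a₀ a, r a₀ a a = 0 := fun a₀ a => by
    by_cases h : a = a₀
    · simp [r, h, hother]
    · simp [r, h]
  have hrs : ∀ a₀ a, ∑ b, r a₀ a b = τ a + τ' a := fun a₀ a => by
    by_cases h : a = a₀ <;> simp [r, h]
  let shift : Fin m → CFIVertex τ ≃ CFIVertex τ' := fun a₀ => cfiShift (r a₀) (hr0 a₀) (hrs a₀)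
  -- The shift depends on the tuple only through its base vertices, which shifting preserves; hence
  -- the inverse can choose the same shift.
  let θ : (Fin k → CFIVertex τ) ≃ (Fin k → CFIVertex τ') :=
    { toFun := fun v i => shift (free fun i => (v i).1.1) (v i)
      invFun := fun v i => (shift (free fun i => (v i).1.1)).symm (v i)
      left_inv := fun v => funext fun i => (shift (free fun i => (v i).1.1)).symm_apply_apply (v i)
      right_inv := fun v => funext fun i =>
        (shift (free fun i => (v i).1.1)).apply_symm_apply (v i) }
  refine not_wlDistinguishes_ofGraph x
    (fun v v' => ∃ a₀ y, IsFlip τ τ' a₀ y ∧ ∀ i, FlipsTo a₀ y (v i) (v' i)) ?_ ?_ θ ?_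
  · rintro v v' ⟨a₀, y, hy, h⟩
    exact sameType_of_flip hy h
  · rintro v v' ⟨a₀, y, hy, h⟩
    -- `b₀` must avoid `a₀` and the `k` pebbled base vertices, which is why `k + 2` base vertices
    -- are needed.
    obtain ⟨b₀, hb₀⟩ := exists_notMem_range hk (Fin.cons a₀ fun i => (v i).1.1 : Fin (k + 1) → Fin m)
    obtain ⟨β, hβ⟩ := exists_flip_answer (hb₀ 0).symm hy h fun i => hb₀ i.succ
    refine ⟨β, fun w => ?_⟩
    obtain ⟨a₁, y₁, hy₁, hv, hw⟩ := hβ w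
    refine ⟨sameType_of_flip hy₁ fun i => ?_, fun i => ⟨a₁, y₁, hy₁, fun j => ?_⟩⟩
    · refine Fin.lastCases ?_ (fun i => ?_) i
      · simpa using hw
      · simpa using hv i
    · by_cases hij : j = i
      · subst hij
        simpa using hw
      · simpa [hij] using hv j
  · intro v
    let a₀ := free fun i => (v i).1.1
    refine ⟨a₀, fun a b => if a = b then 0 else if a = a₀ then τ b + τ' b else
      if b = a₀ then τ a + τ' a else 0, ⟨fun a b => ?_, fun a => by simp, fun a ha => ?_⟩,
      fun i => ⟨hfree (fun i => (v i).1.1) i, Prod.ext rfl ?_⟩⟩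
    · grind
    · rw [Finset.sum_eq_single a₀]
      · simp [ha]
      · intro b _ hb
        simp [ha, hb]
      · simp
    · have hi : (v i).1.1 ≠ a₀ := hfree (fun i => (v i).1.1) i
      have h1 : (θ v i).1.2 = (v i).1.2 + r a₀ (v i).1.1 := rfl
      rw [h1]
      congr 1
      funext b
      simp only [r, hi, if_false, Pi.single_apply]
      grind

end CFI

/-- The `k`-dimensional Weisfeiler-Lehman test misses some pair of non-isomorphic graphs. -/
theorem exists_not_isIso_not_wlDistinguishes {d : ℕ} (k : ℕ) (x : Fin d → ℝ) :
    ∃ A B : FeatGraph d, (∀ v, A.feat v = x) ∧ (∀ v, B.feat v = x) ∧ ¬ A.IsIso B ∧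
      ¬ WLDistinguishes k A B := by
  -- A single odd vertex gives total parity `1`, the obstruction to an isomorphism with the
  -- untwisted graph.
  let τ : Fin (k + 2) → ZMod 2 := Pi.single 0 1
  have := cfiVertex_nonempty (0 : Fin (k + 2) → ZMod 2)
  have := cfiVertex_nonempty τ
  refine ⟨.ofGraph (cfiGraph 0) x, .ofGraph (cfiGraph τ) x, fun _ => rfl, fun _ => rfl, fun h => ?_,
    cfiGraph_not_wlDistinguishes (by omega) x⟩
  exact (cfiGraph_not_iso (τ := τ) (by simp [τ])).false (FeatGraph.nonempty_iso_of_isIso h).some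

end GraphMamba

theorem mainTheorem2 (ε : ℝ) (hε : 0 < ε) (d : ℕ) :
    (∀ (F : Set (Fin d → ℝ)), F.Finite → ∀ (N : ℕ) (δ : ℝ), 0 < δ →
      ∃ g : GraphMamba.GMN d N, ∀ A B : GraphMamba.FeatGraph d,
        A.n ≤ N → B.n ≤ N → (∀ v, A.feat v ∈ F) → (∀ v, B.feat v ∈ F) →
        (A.IsIso B → ∀ a ∈ g.outputs ε A, ∀ b ∈ g.outputs ε B, |a - b| < δ) ∧
        (¬ A.IsIso B → g.Distinguishes ε A B ∧
          ∀ a ∈ g.outputs ε A, ∀ b ∈ g.outputs ε B, 1 ≤ |a - b|)) ∧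
    (∀ (F : Set (Fin d → ℝ)), F.Finite → ∀ N : ℕ,
      ∃ g : GraphMamba.GMN d N, ∀ A B : GraphMamba.FeatGraph d,
        A.n ≤ N → B.n ≤ N → (∀ v, A.feat v ∈ F) → (∀ v, B.feat v ∈ F) →
        ∀ k : ℕ, 1 ≤ k → GraphMamba.WLDistinguishes k A B → g.Distinguishes ε A B) ∧
    (∀ k : ℕ, 1 ≤ k → ∀ x : Fin d → ℝ, ∃ A B : GraphMamba.FeatGraph d,
      (∀ v, A.feat v = x) ∧ (∀ v, B.feat v = x) ∧ ¬ A.IsIso B ∧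
      ¬ GraphMamba.WLDistinguishes k A B ∧
      ∃ (N : ℕ) (g : GraphMamba.GMN d N), A.n ≤ N ∧ B.n ≤ N ∧ g.Distinguishes ε A B) := by
  refine ⟨fun F hF N δ hδ => GraphMamba.exists_gmn_separating hε hF N hδ, fun F hF N => ?_,
    fun k _ x => ?_⟩
  · obtain ⟨g, hg⟩ := GraphMamba.exists_gmn_separating hε hF N one_pos
    exact ⟨g, fun A B hA hB hAF hBF k _ hwl =>
      ((hg A B hA hB hAF hBF).2 fun h => h.not_wlDistinguishes hwl).1⟩
  · obtain ⟨A, B, hAx, hBx, hiso, hwl⟩ := GraphMamba.exists_not_isIso_not_wlDistinguishes k x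
    obtain ⟨g, hg⟩ := GraphMamba.exists_gmn_separating hε (Set.finite_singleton x) (max A.n B.n)
      one_pos
    exact ⟨A, B, hAx, hBx, hiso, hwl, max A.n B.n, g, le_max_left _ _, le_max_right _ _,
      ((hg A B (le_max_left _ _) (le_max_right _ _) hAx hBx).2 hiso).1⟩
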